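/- All Lie algebras are over $\mathbb{C}$. A Banach Lie algebra is a Lie algebra $L$ with a complete norm such that, for some $t>0$, $\|[a,b]\|\le t\|a\|\|b\|$ for all $a,b\in L$. For a Banach Lie algebra $M$, let $P(M)$ be the intersection of all proper closed Lie ideals of finite codimension in $M$, with $P(M)=M$ if there are none. Put $P^0(L)=L$, $P^{\alpha+1}(L)=P(P^\alpha(L))$, and $P^\alpha(L)=\bigcap_{\alpha'<\alpha}P^{\alpha'}(L)$ for limit ordinals $\alpha$. This decreasing transfinite sequence stabilizes; the Frattini radical $\mathcal{F}(L)$ is $P^\beta(L)$ for the least $\beta$ with $P^{\beta+1}(L)=P^\beta(L)$. $L$ is called $\mathcal{F}$-semisimple if $\mathcal{F}(L)=\{0\}$. For a family $G$ of closed subspaces of a Banach space $X$, let $\mathfrak{p}(G)=\bigcap_{Y\in G}Y$ and $\mathfrak{s}(G)=\overline{\sum_{Y\in G}Y}$ (with $\mathfrak{p}(\emptyset)=X$, $\mathfrak{s}(\emptyset)=\{0\}$). $G$ is $\mathfrak{p}$-complete if $G=\{\mathfrak{p}(G'):\emptyset\ne G'\subseteq G\}\cup\{\mathfrak{s}(G)\}$,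 $\mathfrak{s}$-complete if $G=\{\mathfrak{s}(G'):\emptyset\ne G'\subseteq G\}\cup\{\mathfrak{p}(G)\}$, and complete if it is both. $G$ is a lower finite-gap family if for each $Z\in G$ with $Z\ne\mathfrak{p}(G)$ there is $Y\in G$ with $Y\subset Z$ and $0<\dim(Z/Y)<\infty$. A chain is a family linearly ordered by inclusion; a complete chain $C$ is from $\{0\}$ to $L$ if $\mathfrak{p}(C)=\{0\}$ and $\mathfrak{s}(C)=L$. A closed 2-step Lie subideal of $L$ is a closed subspace that is a Lie ideal of some Lie ideal of $L$. **Theorem 8.6.** Let $L$ be a Banach Lie algebra. The following conditions are equivalent: (i) $L$ is $\mathcal{F}$-semisimple. (ii) $L$ has a complete, lower finite-gap chain of closed 2-step Lie subideals from $\{0\}$ to $L$. (iii) $L$ has a complete, lower finite-gap chain of closed Lie subalgebras from $\{0\}$ to $L$. (iv) The set of all closed 2-step Lie subideals of $L$ is a $\mathfrak{p}$-complete, lower finite-gap family. (v) The set of all closed Lie subalgebras of $L$ is a $\mathfrak{p}$-complete, lower finite-gap family. -/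

import Mathlib

universe u

/-- A complex Banach Lie algebra: a complex Lie algebra which is a Banach space and has a
multiplication constant `t > 0` with `‖⁅a, b⁆‖ ≤ t * ‖a‖ * ‖b‖`. -/
class BanachLieAlgebra (L : Type u) extends NormedAddCommGroup L, LieRing L, NormedSpace ℂ L,
    LieAlgebra ℂ L, CompleteSpace L where
  exists_multiplication_constant :
    ∃ t : ℝ, 0 < t ∧ ∀ a b : L, ‖(⁅a, b⁆ : L)‖ ≤ t * ‖a‖ * ‖b‖

namespace BanachLie

/-! ### Families of closed subspaces of a Banach space -/

section Families

variable {X : Type u} [NormedAddCommGroup X] [NormedSpace ℂ X]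

/-- `𝔭(G)`: the intersection of the members of `G` (the whole space if `G = ∅`). -/
def pp (G : Set (ClosedSubmodule ℂ X)) : ClosedSubmodule ℂ X := sInf G

/-- `𝔰(G)`: the closure of the sum of the members of `G` (the zero subspace if `G = ∅`). -/
def ss (G : Set (ClosedSubmodule ℂ X)) : ClosedSubmodule ℂ X := sSup G

/-- The `𝔭`-completion of `G`. -/
def pCompletion (G : Set (ClosedSubmodule ℂ X)) : Set (ClosedSubmodule ℂ X) :=
  {Y | ∃ G' : Set (ClosedSubmodule ℂ X), G'.Nonempty ∧ G' ⊆ G ∧ Y = pp G'} ∪ {ss G}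

/-- The `𝔰`-completion of `G`. -/
def sCompletion (G : Set (ClosedSubmodule ℂ X)) : Set (ClosedSubmodule ℂ X) :=
  {Y | ∃ G' : Set (ClosedSubmodule ℂ X), G'.Nonempty ∧ G' ⊆ G ∧ Y = ss G'} ∪ {pp G}

/-- `G` is `𝔭`-complete. -/
def IsPComplete (G : Set (ClosedSubmodule ℂ X)) : Prop := G = pCompletion G

/-- `G` is `𝔰`-complete. -/
def IsSComplete (G : Set (ClosedSubmodule ℂ X)) : Prop := G = sCompletion G

/-- `G` is complete. -/
def IsCompleteFamily (G : Set (ClosedSubmodule ℂ X)) : Prop := IsPComplete G ∧ IsSComplete G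

/-- The quotient `Z / Y`, for `Y ⊆ Z`, is nonzero and finite-dimensional. -/
def FiniteGap (Y Z : ClosedSubmodule ℂ X) : Prop :=
  Y < Z ∧ FiniteDimensional ℂ (Z.toSubmodule ⧸ Y.toSubmodule.submoduleOf Z.toSubmodule)

/-- Lower finite-gap families: every `Z ∈ G` other than `𝔭(G)` contains some `Y ∈ G` with
`0 < dim (Z / Y) < ∞`. -/
def IsLowerFiniteGap (G : Set (ClosedSubmodule ℂ X)) : Prop :=
  ∀ Z ∈ G, Z ≠ pp G → ∃ Y ∈ G, FiniteGap Y Z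

/-- `C` is a complete, lower finite-gap chain of closed subspaces from `{0}` to `X`. -/
def IsCompleteLowerFiniteGapChain (C : Set (ClosedSubmodule ℂ X)) : Prop :=
  IsChain (· ≤ ·) C ∧ IsCompleteFamily C ∧ IsLowerFiniteGap C ∧ pp C = ⊥ ∧ ss C = ⊤

end Families

/-! ### Closed subalgebras and closed 2-step subideals -/

section Subalgebras

variable (L : Type u) [BanachLieAlgebra L]

/-- The family of all closed Lie subalgebras of `L`. -/
def closedSubalgebras : Set (ClosedSubmodule ℂ L) :=
  {Y | ∃ M : LieSubalgebra ℂ L, M.toSubmodule = Y.toSubmodule}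

/-- The family of all closed 2-step Lie subideals of `L`: closed subspaces that are Lie ideals
of some Lie ideal `K` of `L`. -/
def closedTwoStepSubideals : Set (ClosedSubmodule ℂ L) :=
  {Y | ∃ (K : LieIdeal ℂ L) (I : LieIdeal ℂ K),
    I.toSubmodule.map K.toSubmodule.subtype = Y.toSubmodule}

end Subalgebras

/-! ### The Frattini radical -/

section Frattini

/-- The preradical `P_𝔍`: the intersection of all proper closed Lie ideals of finite codimension
(the whole algebra if there are none). -/
def idealPreradical (M : Type u) [TopologicalSpace M] [LieRing M] [LieAlgebra ℂ M] :
    LieIdeal ℂ M :=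
  sInf {I : LieIdeal ℂ M | IsClosed (I : Set M) ∧ I ≠ ⊤ ∧ FiniteDimensional ℂ (M ⧸ I)}

variable (L : Type u) [BanachLieAlgebra L]

/-- `P_𝔍(M)` for a Lie subalgebra `M` of `L`, where `M` is regarded as a Lie algebra in its own
right (with the topology induced by `L`) and the result as a Lie subalgebra of `L`. -/
def idealPreradicalOf (M : LieSubalgebra ℂ L) : LieSubalgebra ℂ L :=
  (idealPreradical M).toLieSubalgebra.map M.incl

/-- The superposition series of `P_𝔍`: `L` at `0`, then `P_𝔍` applied at successors, and
intersections at limits. -/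
noncomputable def frattiniSeries (α : Ordinal.{u}) : LieSubalgebra ℂ L :=
  Ordinal.limitRecOn α ⊤ (fun _ M => idealPreradicalOf L M)
    (fun β _ S => ⨅ γ : Set.Iio β, S γ.1 γ.2)

theorem idealPreradicalOf_le (M : LieSubalgebra ℂ L) : idealPreradicalOf L M ≤ M := by
  rintro x ⟨y, -, rfl⟩
  exact y.2

theorem frattiniSeries_zero : frattiniSeries L 0 = ⊤ := by
  simp [frattiniSeries]

theorem frattiniSeries_add_one (α : Ordinal.{u}) :
    frattiniSeries L (α + 1) = idealPreradicalOf L (frattiniSeries L α) := by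
  simp [frattiniSeries]

theorem frattiniSeries_limit (α : Ordinal.{u}) (h : Order.IsSuccLimit α) :
    frattiniSeries L α = ⨅ γ : Set.Iio α, frattiniSeries L γ.1 := by
  simp [frattiniSeries, Ordinal.limitRecOn_limit _ _ _ _ h]

theorem frattiniSeries_antitone : Antitone (frattiniSeries L) := by
  intro α β
  induction β using Ordinal.limitRecOn with
  | zero =>
    intro h
    rw [nonpos_iff_eq_zero.mp h]
  | add_one β ih =>
    intro h
    rcases h.lt_or_eq with h | rfl
    · rw [frattiniSeries_add_one]
      exact (idealPreradicalOf_le L _).trans (ih (Order.lt_add_one_iff.mp h))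
    · exact le_rfl
  | limit β hβ _ =>
    intro h
    rcases h.lt_or_eq with h | rfl
    · rw [frattiniSeries_limit L β hβ]
      exact iInf_le (fun γ : Set.Iio β => frattiniSeries L γ.1) ⟨α, h⟩
    · exact le_rfl

/-- The series stabilizes, so that the least ordinal used in `frattiniRadical` exists. -/
theorem exists_frattiniSeries_stable :
    ∃ β : Ordinal.{u}, frattiniSeries L (β + 1) = frattiniSeries L β := by
  by_contra! h
  have hs : StrictAnti (frattiniSeries L) := by
    intro α β hαβ
    refine lt_of_le_of_lt (frattiniSeries_antitone L (Order.add_one_le_of_lt hαβ)) ?_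
    exact lt_of_le_of_ne (frattiniSeries_antitone L (Order.le_succ α)) (h α)
  exact not_injective_of_ordinal (frattiniSeries L) hs.injective

/-- The Frattini radical `𝓕(L) = P_𝔍°(L)`: the value of the superposition series at the least
ordinal `β` at which it stabilizes. -/
noncomputable def frattiniRadical : LieSubalgebra ℂ L :=
  frattiniSeries L (sInf {β : Ordinal.{u} | frattiniSeries L (β + 1) = frattiniSeries L β})

/-- `L` is `𝓕`-semisimple. -/
def IsFrattiniSemisimple : Prop := frattiniRadical L = ⊥

end Frattini

end BanachLie

/-! Two facts carry the theorem; the rest is bookkeeping with families of subspaces.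

First, every term of the Frattini series is a closed ideal of `L`, although an ideal of an ideal
need not be one. The automorphisms `exp (t ad a)` permute the closed ideals of finite codimension of
a closed ideal `M`, hence preserve their intersection, and differentiating at `t = 0` gives
invariance under `ad a` (`lie_mem_idealPreradicalOf`). If `L` is semisimple, a nonzero closed `Z`
lies in some term `K` but not in the next, so a closed ideal of `K` of finite codimension cuts a
finite gap below `Z` (`IsFrattiniSemisimple.exists_finiteGap`). The cut preserves subalgebras and
2-step subideals. Iterating such cuts transfinitely gives the chains
(`exists_isCompleteLowerFiniteGapChain`).

Second, a proper closed subalgebra of finite codimension forces a proper closed ideal of finite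
codimension (`hasFiniteCodimIdeal_of_subalgebra`). Take the subalgebra `H` maximal, let `W` be the
finite-dimensional space of functionals vanishing on `H`, and suppose there is no such ideal. An
Engel argument shows that `L` is spanned modulo `H` by vectors `v` of nonzero weight for elements of
`H`. Such a `v` shifts weights under the coadjoint action, while eigenvalues of the coadjoint action
of `x` are bounded by `‖ad x‖`; so high powers of `v` drop in the filtration of `U(L) W` by word
length. By pigeonhole and reordering of words the filtration stabilizes, and the common kernel of
the resulting finite-dimensional invariant space is the forbidden ideal.

Given a chain of subalgebras, compare the radical `M`, which satisfies `P(M) = M`, with the least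
member containing it: the gap below that member meets `M` in a subalgebra contradicting the second
fact. -/

namespace BanachLie

/-! ### Exponentials of bounded operators and of inner derivations -/

section OperatorExp

variable {X : Type u} [NormedAddCommGroup X] [NormedSpace ℂ X] [CompleteSpace X]

theorem hasDerivAt_exp_smul_apply (D : X →L[ℂ] X) (v : X) (t : ℂ) :
    HasDerivAt (fun s : ℂ => NormedSpace.exp (s • D) v) (D (NormedSpace.exp (t • D) v)) t := by
  have h := (hasDerivAt_exp_smul_const' (𝕂 := ℂ) D t).clm_apply (hasDerivAt_const t v)
  simpa using h

/-- A closed subspace invariant under `D` is invariant under `exp D`. -/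
theorem exp_apply_mem (D : X →L[ℂ] X) {C : Submodule ℂ X} (hC : IsClosed (C : Set X))
    (h : ∀ v ∈ C, D v ∈ C) {v : X} (hv : v ∈ C) : NormedSpace.exp D v ∈ C := by
  have h1 := NormedSpace.exp_series_hasSum_exp' (𝕂 := ℂ) D
  have h2 := h1.mapL (ContinuousLinearMap.apply ℂ X v)
  refine hC.mem_of_tendsto h2 (Filter.Eventually.of_forall fun s => C.sum_mem fun n _ => ?_)
  simp only [ContinuousLinearMap.apply_apply, smul_apply]
  refine C.smul_mem _ ?_
  clear * - hv h
  induction n with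
  | zero => simpa using hv
  | succ n ih => rw [pow_succ']; exact h _ ih

/-- A closed subspace containing the orbit of `v` under the group `exp (t D)` contains `D v`. -/
theorem apply_mem_of_exp_mem (D : X →L[ℂ] X) {C : Submodule ℂ X} (hC : IsClosed (C : Set X))
    {v : X} (h : ∀ t : ℂ, NormedSpace.exp (t • D) v ∈ C) : D v ∈ C := by
  have hd := hasDerivAt_exp_smul_apply D v 0
  rw [hasDerivAt_iff_tendsto_slope] at hd
  simp only [zero_smul, NormedSpace.exp_zero, one_apply_eq_self] at hd
  refine hC.mem_of_tendsto hd (Filter.Eventually.of_forall fun t => ?_)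
  rw [slope_def_module]
  exact C.smul_mem _ (C.sub_mem (h t) (h 0))

theorem exp_neg_exp_apply (D : X →L[ℂ] X) (v : X) :
    NormedSpace.exp (-D) (NormedSpace.exp D v) = v := by
  let _ : NormedAlgebra ℚ (X →L[ℂ] X) := NormedAlgebra.restrictScalars ℚ ℂ (X →L[ℂ] X)
  have h := (NormedSpace.exp_add_of_commute (𝔸 := X →L[ℂ] X) (x := -D) (y := D)
    ((Commute.refl D).neg_left)).symm
  rw [neg_add_cancel, NormedSpace.exp_zero] at h
  exact congrArg (fun A : X →L[ℂ] X => A v) h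

theorem exp_exp_neg_apply (D : X →L[ℂ] X) (v : X) :
    NormedSpace.exp D (NormedSpace.exp (-D) v) = v := by
  simpa using exp_neg_exp_apply (-D) v

end OperatorExp

variable {L : Type u} [BanachLieAlgebra L]

variable (L) in
/-- The adjoint representation, as a continuous bilinear map. -/
noncomputable def adL : L →L[ℂ] L →L[ℂ] L :=
  LinearMap.mkContinuous₂ (LieModule.toEnd ℂ L L : L →ₗ[ℂ] Module.End ℂ L)
    (BanachLieAlgebra.exists_multiplication_constant (L := L)).choose
    (BanachLieAlgebra.exists_multiplication_constant (L := L)).choose_spec.2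

@[simp]
theorem adL_apply (a b : L) : adL L a b = ⁅a, b⁆ := rfl

/-- Since `D = ad a` is a derivation, `exp (-tD) ⁅exp (tD) x, exp (tD) y⁆` has zero derivative in
`t`; compare `t = 1` with `t = 0`. -/
theorem exp_adL_lie (a x y : L) :
    NormedSpace.exp (adL L a) ⁅x, y⁆ =
      ⁅NormedSpace.exp (adL L a) x, NormedSpace.exp (adL L a) y⁆ := by
  set D := adL L a
  let φ : ℂ → L := fun t => NormedSpace.exp (t • -D)
    ⁅NormedSpace.exp (t • D) x, NormedSpace.exp (t • D) y⁆
  have hφ : ∀ t, HasDerivAt φ 0 t := by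
    intro t
    have h1 := ((adL L).hasFDerivAt.comp_hasDerivAt t
      (hasDerivAt_exp_smul_apply D x t)).clm_apply (hasDerivAt_exp_smul_apply D y t)
    have h2 := (hasDerivAt_exp_smul_const (𝕂 := ℂ) (-D) t).clm_apply h1
    refine h2.congr_deriv ?_
    simp only [mul_apply_eq_comp, Function.comp,
      adL_apply, neg_apply, D, leibniz_lie a, map_add, map_neg]
    abel
  have hc : φ 1 = φ 0 :=
    is_const_of_deriv_eq_zero (fun t => (hφ t).differentiableAt) (fun t => (hφ t).deriv) 1 0
  have h3 : NormedSpace.exp (-D) ⁅NormedSpace.exp D x, NormedSpace.exp D y⁆ = ⁅x, y⁆ := by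
    simpa [φ] using hc
  rw [← h3, exp_exp_neg_apply]

/-! ### The Frattini series consists of closed ideals -/

/-- The restriction of `exp (ad a)` to an invariant closed subalgebra. -/
noncomputable def expAdRestrict (M : LieSubalgebra ℂ L) (hM : IsClosed (M : Set L)) (a : L)
    (h : ∀ z ∈ M, ⁅a, z⁆ ∈ M) : M →ₗ⁅ℂ⁆ M where
  toLinearMap := (NormedSpace.exp (adL L a) : L →L[ℂ] L).toLinearMap.restrict
    (p := M.toSubmodule) (q := M.toSubmodule)
    (fun _ hz => exp_apply_mem (C := M.toSubmodule) (adL L a) hM h hz)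
  map_lie' {x y} := Subtype.ext (exp_adL_lie a (x : L) (y : L))

theorem coe_expAdRestrict (M : LieSubalgebra ℂ L) (hM : IsClosed (M : Set L)) (a : L)
    (h : ∀ z ∈ M, ⁅a, z⁆ ∈ M) (z : M) :
    (expAdRestrict M hM a h z : L) = NormedSpace.exp (adL L a) (z : L) := rfl

theorem expAdRestrict_surjective (M : LieSubalgebra ℂ L) (hM : IsClosed (M : Set L)) (a : L)
    (h : ∀ z ∈ M, ⁅a, z⁆ ∈ M) : Function.Surjective (expAdRestrict M hM a h) := by
  intro z
  have h' : ∀ z ∈ M, ⁅-a, z⁆ ∈ M := fun z hz => by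
    rw [neg_lie]; exact M.neg_mem (h z hz)
  refine ⟨expAdRestrict M hM (-a) h' z, Subtype.ext ?_⟩
  rw [coe_expAdRestrict, coe_expAdRestrict, map_neg, exp_exp_neg_apply]

theorem mem_idealPreradical {M : Type u} [TopologicalSpace M] [LieRing M] [LieAlgebra ℂ M] {z : M} :
    z ∈ idealPreradical M ↔ ∀ I : LieIdeal ℂ M, IsClosed (I : Set M) → I ≠ ⊤ →
      FiniteDimensional ℂ (M ⧸ I) → z ∈ I := by
  rw [← SetLike.mem_coe, idealPreradical, LieSubmodule.coe_sInf]
  simp only [Set.mem_iInter, Set.mem_ofPred_eq, SetLike.mem_coe, and_imp]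

theorem mem_idealPreradicalOf {M : LieSubalgebra ℂ L} {z : L} :
    z ∈ idealPreradicalOf L M ↔ ∃ hz : z ∈ M, ∀ I : LieIdeal ℂ M, IsClosed (I : Set M) → I ≠ ⊤ →
      FiniteDimensional ℂ (M ⧸ I) → (⟨z, hz⟩ : M) ∈ I := by
  constructor
  · rintro ⟨y, hy, rfl⟩
    refine ⟨y.2, fun I h1 h2 h3 => ?_⟩
    exact mem_idealPreradical.mp hy I h1 h2 h3
  · rintro ⟨hz, h⟩
    refine ⟨⟨z, hz⟩, ?_, rfl⟩
    exact mem_idealPreradical.mpr h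

theorem isClosed_idealPreradicalOf {M : LieSubalgebra ℂ L} (hM : IsClosed (M : Set L)) :
    IsClosed (idealPreradicalOf L M : Set L) := by
  have h : (idealPreradicalOf L M : Set L) = Subtype.val '' (idealPreradical M : Set M) := by
    ext z
    constructor
    · rintro ⟨y, hy, rfl⟩; exact ⟨y, hy, rfl⟩
    · rintro ⟨y, hy, rfl⟩; exact ⟨y, hy, rfl⟩
  rw [h]
  refine hM.isClosedEmbedding_subtypeVal.isClosedMap _ ?_
  have h2 : (idealPreradical M : Set M) =
      ⋂ I ∈ {I : LieIdeal ℂ M | IsClosed (I : Set M) ∧ I ≠ ⊤ ∧ FiniteDimensional ℂ (M ⧸ I)},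
        (I : Set M) := LieSubmodule.coe_sInf _
  rw [h2]
  exact isClosed_biInter fun I hI => hI.1

/-- The restriction of `exp (ad a)` is a continuous surjective endomorphism of `M`, so it pulls
proper closed ideals of finite codimension back to ideals of the same kind. -/
theorem exp_mem_idealPreradicalOf {M : LieSubalgebra ℂ L} (hM : IsClosed (M : Set L)) (a : L)
    (h : ∀ z ∈ M, ⁅a, z⁆ ∈ M) {z : L} (hz : z ∈ idealPreradicalOf L M) :
    NormedSpace.exp (adL L a) z ∈ idealPreradicalOf L M := by
  obtain ⟨hzM, hz⟩ := mem_idealPreradicalOf.mp hz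
  set φ := expAdRestrict M hM a h
  have hφc : Continuous φ :=
    Continuous.subtype_mk ((NormedSpace.exp (adL L a)).continuous.comp continuous_subtype_val) _
  refine mem_idealPreradicalOf.mpr ⟨(φ ⟨z, hzM⟩).2, fun I h1 h2 h3 => ?_⟩
  have key := hz (I.comap φ) ?_ ?_ ?_
  · exact LieIdeal.mem_comap.mp key
  · exact h1.preimage hφc
  · intro htop
    refine h2 (eq_top_iff.mpr fun y _ => ?_)
    obtain ⟨x, rfl⟩ := expAdRestrict_surjective M hM a h y
    exact LieIdeal.mem_comap.mp (htop ▸ LieSubmodule.mem_top x)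
  · let ψ : M →ₗ[ℂ] M := φ
    have hle : (I.comap φ).toSubmodule = (I.toSubmodule).comap ψ := rfl
    have hinj : Function.Injective
        ((I.comap φ).toSubmodule.mapQ I.toSubmodule ψ hle.le) := by
      rw [← LinearMap.ker_eq_bot, Submodule.ker_mapQ, ← hle]
      exact Submodule.mkQ_map_self _
    have : FiniteDimensional ℂ (M ⧸ I.toSubmodule) := h3
    exact Module.Finite.of_injective _ hinj

/-- Differentiate the invariance under `exp (t ad a)` at `t = 0`, inside a closed subspace. -/
theorem lie_mem_idealPreradicalOf {M : LieSubalgebra ℂ L} (hM : IsClosed (M : Set L))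
    (h : ∀ a : L, ∀ z ∈ M, ⁅a, z⁆ ∈ M) (a : L) {z : L} (hz : z ∈ idealPreradicalOf L M) :
    ⁅a, z⁆ ∈ idealPreradicalOf L M := by
  refine apply_mem_of_exp_mem (C := (idealPreradicalOf L M).toSubmodule) (adL L a)
    (isClosed_idealPreradicalOf hM) fun t => ?_
  rw [← map_smul]
  exact exp_mem_idealPreradicalOf hM (t • a) (h (t • a)) hz

theorem mem_iInf_lieSubalgebra {ι : Sort*} {S : ι → LieSubalgebra ℂ L} {z : L} :
    z ∈ ⨅ i, S i ↔ ∀ i, z ∈ S i := by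
  rw [← SetLike.mem_coe, iInf, LieSubalgebra.coe_sInf]
  simp

theorem frattiniSeries_isClosed_and_lie_mem (α : Ordinal.{u}) :
    IsClosed (frattiniSeries L α : Set L) ∧
      ∀ a : L, ∀ z ∈ frattiniSeries L α, ⁅a, z⁆ ∈ frattiniSeries L α := by
  induction α using Ordinal.limitRecOn with
  | zero => simp [frattiniSeries_zero]
  | add_one β ih =>
    rw [frattiniSeries_add_one]
    exact ⟨isClosed_idealPreradicalOf ih.1, fun a z hz => lie_mem_idealPreradicalOf ih.1 ih.2 a hz⟩
  | limit β hβ ih =>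
    rw [frattiniSeries_limit L β hβ]
    constructor
    · rw [iInf, LieSubalgebra.coe_sInf]
      refine isClosed_biInter ?_
      rintro _ ⟨γ, rfl⟩
      exact (ih γ.1 γ.2).1
    · intro a z hz
      rw [mem_iInf_lieSubalgebra] at hz ⊢
      exact fun γ => (ih γ.1 γ.2).2 a z (hz γ)

/-! ### Closed subalgebras of finite codimension -/

/-! ### Linear algebra: Engel's theorem, dimension counts, continuity -/

section LinearAlgebra

/-- Engel's theorem, phrased for a bare bracket-compatible map so that no module instance has to be
fixed on `V` beforehand. -/
theorem exists_ne_zero_of_forall_isNilpotent {H V : Type*} [LieRing H] [LieAlgebra ℂ H]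
    [AddCommGroup V] [Module ℂ V] [FiniteDimensional ℂ V] [Nontrivial V]
    (φ : H →ₗ[ℂ] Module.End ℂ V) (hφ : ∀ x y v, φ x (φ y v) = φ y (φ x v) + φ ⁅x, y⁆ v)
    (h : ∀ x, IsNilpotent (φ x)) : ∃ v : V, v ≠ 0 ∧ ∀ x, φ x v = 0 := by
  let _ : LieRingModule H V :=
    { bracket x v := φ x v
      add_lie x y v := by simp [map_add]
      lie_add x v w := map_add (φ x) v w
      leibniz_lie x y v := by
        change φ x (φ y v) = φ ⁅x, y⁆ v + φ y (φ x v)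
        rw [hφ, add_comm] }
  have _ : LieModule ℂ H V :=
    { smul_lie c x v := by change φ (c • x) v = c • φ x v; simp
      lie_smul c x v := map_smul (φ x) c v }
  have hn : LieModule.IsNilpotent H V :=
    (LieModule.isNilpotent_iff_forall' (R := ℂ)).mpr h
  have := LieModule.nontrivial_max_triv_of_isNilpotent ℂ H V
  obtain ⟨v, hv⟩ := exists_ne (0 : LieModule.maxTrivSubmodule ℂ H V)
  exact ⟨v, fun h0 => hv (Subtype.ext h0), fun x => v.2 x⟩

theorem surjective_of_finrank_le {X V : Type*} [AddCommGroup X] [Module ℂ X] [AddCommGroup V]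
    [Module ℂ V] [FiniteDimensional ℂ V] {P : Submodule ℂ X} (ψ : X →ₗ[ℂ] V)
    (hker : ∀ y, ψ y = 0 ↔ y ∈ P) (h : Module.finrank ℂ V ≤ Module.finrank ℂ (X ⧸ P)) :
    Function.Surjective ψ := by
  obtain rfl : LinearMap.ker ψ = P := Submodule.ext hker
  rw [ψ.quotKerEquivRange.finrank_eq] at h
  exact LinearMap.range_eq_top.mp (Submodule.eq_top_of_finrank_eq
    (le_antisymm (Submodule.finrank_le _) h))

/-- An injective `B` is bijective on the finite-dimensional invariant `Q`, so it stays injective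
modulo `Q`. Thus a scalar that is not an eigenvalue on `X` is not one on `X ⧸ Q` either. -/
theorem mem_of_pow_apply_mem {X : Type*} [AddCommGroup X] [Module ℂ X] {B : Module.End ℂ X}
    (hB : Function.Injective B) {Q : Submodule ℂ X} [FiniteDimensional ℂ Q]
    (hQ : ∀ g ∈ Q, B g ∈ Q) (n : ℕ) {g : X} (hg : (B ^ n) g ∈ Q) : g ∈ Q := by
  have hs : Function.Surjective (B.restrict hQ) :=
    LinearMap.surjective_of_injective fun a b hab =>
      Subtype.ext (hB (congrArg Subtype.val hab))
  induction n generalizing g with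
  | zero => simpa using hg
  | succ n ih =>
    have h1 : B g ∈ Q := ih (by rwa [pow_succ, Module.End.mul_apply] at hg)
    obtain ⟨k, hk⟩ := hs ⟨B g, h1⟩
    rw [← hB (congrArg Subtype.val hk)]
    exact k.2

theorem mapQ_sub_smul_pow_mk {X : Type*} [AddCommGroup X] [Module ℂ X] {H : Submodule ℂ X}
    {A : Module.End ℂ X} (hA : H ≤ H.comap A) (c : ℂ) (n : ℕ) (z : X) :
    ((H.mapQ H A hA - c • (1 : Module.End ℂ (X ⧸ H))) ^ n) (Submodule.Quotient.mk z) =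
      Submodule.Quotient.mk (((A - c • (1 : Module.End ℂ X)) ^ n) z) := by
  induction n generalizing z with
  | zero => rfl
  | succ n ih =>
    rw [pow_succ, pow_succ, Module.End.mul_apply, Module.End.mul_apply, ← ih]
    rfl

theorem continuous_of_le_ker {X : Type u} [NormedAddCommGroup X] [NormedSpace ℂ X]
    {H : Submodule ℂ X} (hH : IsClosed (H : Set X)) [FiniteDimensional ℂ (X ⧸ H)]
    (φ : X →ₗ[ℂ] ℂ) (h : H ≤ LinearMap.ker φ) : Continuous φ := by
  have _ : IsClosed (H : Set X) := hH
  have h1 : Continuous (H.liftQ φ h) := LinearMap.continuous_of_finiteDimensional _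
  exact h1.comp (continuous_quot_mk : Continuous (Submodule.Quotient.mk : X → X ⧸ H))

end LinearAlgebra

/-! ### The coadjoint action on continuous functionals -/

variable (L) in
/-- `L` has a proper closed ideal of finite codimension. -/
def HasFiniteCodimIdeal : Prop :=
  ∃ I : LieIdeal ℂ L, IsClosed (I : Set L) ∧ I ≠ ⊤ ∧ FiniteDimensional ℂ (L ⧸ I)

variable (L) in
/-- The coadjoint representation on continuous functionals. -/
noncomputable def coad : L →ₗ[ℂ] Module.End ℂ (StrongDual ℂ L) where
  toFun y :=
    { toFun f := -(f.comp (adL L y))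
      map_add' f g := by ext; simp; abel
      map_smul' c f := by ext; simp }
  map_add' y z := by ext; simp; abel
  map_smul' c y := by ext; simp

@[simp]
theorem coad_apply (y z : L) (f : StrongDual ℂ L) : coad L y f z = -f ⁅y, z⁆ := rfl

theorem coad_coad (x y : L) (f : StrongDual ℂ L) :
    coad L x (coad L y f) = coad L y (coad L x f) + coad L ⁅x, y⁆ f := by
  ext z
  simp only [coad_apply, add_apply, neg_neg, lie_lie, map_sub]
  abel

theorem coad_pow_apply (x z : L) (f : StrongDual ℂ L) (n : ℕ) :
    ((coad L x ^ n) f) z = (-1) ^ n * f ((LieAlgebra.ad ℂ L x ^ n) z) := by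
  induction n generalizing f z with
  | zero => simp
  | succ n ih =>
    rw [pow_succ, Module.End.mul_apply, ih, coad_apply, pow_succ' (LieAlgebra.ad ℂ L x),
      Module.End.mul_apply, LieAlgebra.ad_apply, pow_succ]
    ring

/-- An eigenvalue of the coadjoint action of `x` has modulus at most `‖ad x‖`. This is how the norm
enters the weight argument. -/
theorem coad_sub_smul_injective {x : L} {μ : ℂ} (h : ‖adL L x‖ < ‖μ‖) :
    Function.Injective (coad L x - μ • (1 : Module.End ℂ (StrongDual ℂ L))) := by
  rw [injective_iff_map_eq_zero]
  intro f hf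
  by_contra h0
  have h1 : coad L x f = μ • f := by simpa [sub_eq_zero] using hf
  have h2 : ‖μ • f‖ ≤ ‖f‖ * ‖adL L x‖ := by
    rw [← h1]
    change ‖-(f.comp (adL L x))‖ ≤ _
    rw [norm_neg]
    exact ContinuousLinearMap.opNorm_comp_le _ _
  rw [norm_smul] at h2
  have h3 := norm_pos_iff.mpr h0
  nlinarith

/-- The functionals vanishing on `H`. -/
def annihilator (H : LieSubalgebra ℂ L) : Submodule ℂ (StrongDual ℂ L) where
  carrier := {f | ∀ x ∈ H, f x = 0}
  add_mem' hf hg x hx := by simp [hf x hx, hg x hx]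
  zero_mem' x _ := by simp
  smul_mem' c f hf x hx := by simp [hf x hx]

/-- The stabilizer of a functional under the coadjoint representation. -/
def stabilizer (f : StrongDual ℂ L) : LieSubalgebra ℂ L where
  carrier := {x | coad L x f = 0}
  add_mem' {x y} hx hy := by
    change coad L (x + y) f = 0
    rw [map_add, LinearMap.add_apply, Set.mem_ofPred.mp hx, Set.mem_ofPred.mp hy, add_zero]
  zero_mem' := by simp
  smul_mem' c x hx := by
    change coad L (c • x) f = 0
    rw [map_smul, LinearMap.smul_apply, Set.mem_ofPred.mp hx, smul_zero]
  lie_mem' {x y} hx hy := by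
    change coad L ⁅x, y⁆ f = 0
    have h := coad_coad x y f
    have hx' : coad L x f = 0 := hx
    have hy' : coad L y f = 0 := hy
    rw [hx', hy', map_zero, map_zero, zero_add] at h
    exact h.symm

theorem mem_stabilizer {f : StrongDual ℂ L} {x : L} : x ∈ stabilizer f ↔ coad L x f = 0 := Iff.rfl

/-! ### Functionals vanishing on a subalgebra of finite codimension -/

section Subalgebra

variable {H : LieSubalgebra ℂ L}

theorem coad_mem_annihilator {x : L} (hx : x ∈ H) {f : StrongDual ℂ L} (hf : f ∈ annihilator H) :
    coad L x f ∈ annihilator H := fun z hz => by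
  rw [coad_apply, hf _ (H.lie_mem hx hz), neg_zero]

/-- Functionals vanishing on `H`, as functionals on the quotient. -/
noncomputable def annihilatorToDual (H : LieSubalgebra ℂ L) :
    annihilator H →ₗ[ℂ] Module.Dual ℂ (L ⧸ H.toSubmodule) where
  toFun f := H.toSubmodule.liftQ (f : L →ₗ[ℂ] ℂ) f.2
  map_add' f g := by ext; rfl
  map_smul' c f := by ext; rfl

theorem annihilatorToDual_injective : Function.Injective (annihilatorToDual H) := by
  intro f g hfg
  ext z
  exact congrArg (fun φ => φ (Submodule.Quotient.mk z)) hfg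

instance [FiniteDimensional ℂ (L ⧸ H.toSubmodule)] : FiniteDimensional ℂ (annihilator H) :=
  Module.Finite.of_injective _ annihilatorToDual_injective

theorem finrank_annihilator_le [FiniteDimensional ℂ (L ⧸ H.toSubmodule)] :
    Module.finrank ℂ (annihilator H) ≤ Module.finrank ℂ (L ⧸ H.toSubmodule) := by
  rw [← Subspace.dual_finrank_eq (K := ℂ) (V := L ⧸ H.toSubmodule)]
  exact LinearMap.finrank_le_finrank_of_injective annihilatorToDual_injective

theorem hasFiniteCodimIdeal_of_lie_mem (hc : IsClosed (H : Set L)) (hH : H ≠ ⊤)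
    [FiniteDimensional ℂ (L ⧸ H.toSubmodule)] (h : ∀ x : L, ∀ y ∈ H, ⁅x, y⁆ ∈ H) :
    HasFiniteCodimIdeal L := by
  obtain ⟨I, rfl⟩ := (LieSubalgebra.exists_lieIdeal_coe_eq_iff ℂ H).mpr fun x y hy => h x y hy
  refine ⟨I, hc, ?_, ‹_›⟩
  rintro rfl
  exact hH (by ext; simp)

theorem hasFiniteCodimIdeal_of_stabilizer_eq_top {f : StrongDual ℂ L} (hf : f ≠ 0)
    (h : stabilizer f = ⊤) : HasFiniteCodimIdeal L := by
  let I : LieIdeal ℂ L :=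
    { LinearMap.ker (f : L →ₗ[ℂ] ℂ) with
      lie_mem := fun {x y} _ => by
        have hx : coad L x f = 0 := mem_stabilizer.mp (h ▸ LieSubalgebra.mem_top x)
        have := congrArg (fun g : StrongDual ℂ L => g y) hx
        simpa using this }
  refine ⟨I, f.isClosed_ker, ?_, ?_⟩
  · intro htop
    refine hf (ContinuousLinearMap.ext fun z => ?_)
    have hz : z ∈ I := htop ▸ LieSubmodule.mem_top z
    exact hz
  · exact Module.Finite.equiv (LinearMap.quotKerEquivRange (f : L →ₗ[ℂ] ℂ)).symm

theorem exists_coad_eq [FiniteDimensional ℂ (L ⧸ H.toSubmodule)] {f : StrongDual ℂ L}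
    (hst : stabilizer f = H) (hrange : ∀ y, coad L y f ∈ annihilator H) {g : StrongDual ℂ L}
    (hg : g ∈ annihilator H) : ∃ y, coad L y f = g := by
  let ψ : L →ₗ[ℂ] annihilator H :=
    ((coad L).flip f).codRestrict _ hrange
  have hker : ∀ y, ψ y = 0 ↔ y ∈ H.toSubmodule := fun y =>
    Subtype.ext_iff.trans (SetLike.ext_iff.mp hst y)
  obtain ⟨y, hy⟩ := surjective_of_finrank_le (X := L) (V := annihilator H)
    (P := H.toSubmodule) ψ hker finrank_annihilator_le ⟨g, hg⟩
  exact ⟨y, congrArg Subtype.val hy⟩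

/-- A maximal subalgebra with a nonzero functional invariant under it and vanishing on it. -/
theorem hasFiniteCodimIdeal_of_invariant (hc : IsClosed (H : Set L)) (hH : IsCoatom H)
    [FiniteDimensional ℂ (L ⧸ H.toSubmodule)] {f : StrongDual ℂ L} (hf : f ∈ annihilator H)
    (h0 : f ≠ 0) (hinv : ∀ x ∈ H, coad L x f = 0) : HasFiniteCodimIdeal L := by
  have hle : H ≤ stabilizer f := hinv
  rcases hH.le_iff.mp hle with hst | hst
  · exact hasFiniteCodimIdeal_of_stabilizer_eq_top h0 hst
  have hrange : ∀ y, coad L y f ∈ annihilator H := fun y x hx => by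
    have := congrArg (fun g : StrongDual ℂ L => g y) (hinv x hx)
    rw [coad_apply, ← lie_skew, map_neg, neg_neg]
    simpa using this
  have hsurj : ∀ g ∈ annihilator H, ∃ y, coad L y f = g := fun g hg =>
    exists_coad_eq hst hrange hg
  -- With `y · f = f`, the element `y` is outside `H`, yet `⁅y, x⁆ · f = -(x · f) = 0` for `x ∈ H`;
  -- so `y` normalizes `H`, and maximality makes `H` an ideal.
  obtain ⟨y, hy⟩ := hsurj f hf
  have hyH : y ∉ H := fun hmem => h0 (by rw [← hy, hinv y hmem])
  have hyn : y ∈ H.normalizer := by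
    rw [LieSubalgebra.mem_normalizer_iff]
    intro x hx
    rw [← hst, mem_stabilizer]
    have h1 := coad_coad y x f
    rw [hinv x hx, map_zero, hy, hinv x hx, zero_add] at h1
    exact h1.symm
  have hnt : H.normalizer = ⊤ := by
    rcases hH.le_iff.mp H.le_normalizer with h | h
    · exact h
    · exact absurd (h ▸ hyn) hyH
  refine hasFiniteCodimIdeal_of_lie_mem hc hH.1 fun x y hy => ?_
  exact (LieSubalgebra.mem_normalizer_iff H x).mp (hnt ▸ LieSubalgebra.mem_top x) y hy

/-- The functionals vanishing on `H` on which every element of `H` acts nilpotently. -/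
def nilpotentPart (H : LieSubalgebra ℂ L) : Submodule ℂ (StrongDual ℂ L) where
  carrier := {f | f ∈ annihilator H ∧ ∀ x ∈ H, ∀ z,
    f ((LieAlgebra.ad ℂ L x ^ Module.finrank ℂ (L ⧸ H.toSubmodule)) z) = 0}
  add_mem' hf hg := ⟨add_mem hf.1 hg.1, fun x hx z => by simp [hf.2 x hx z, hg.2 x hx z]⟩
  zero_mem' := ⟨zero_mem _, by simp⟩
  smul_mem' c f hf := ⟨Submodule.smul_mem _ c hf.1, fun x hx z => by simp [hf.2 x hx z]⟩

theorem exp_adL_ad_pow (y x z : L) (n : ℕ) :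
    NormedSpace.exp (adL L y) ((LieAlgebra.ad ℂ L x ^ n) z) =
      (LieAlgebra.ad ℂ L (NormedSpace.exp (adL L y) x) ^ n) (NormedSpace.exp (adL L y) z) := by
  induction n generalizing z with
  | zero => rfl
  | succ n ih =>
    rw [pow_succ, pow_succ, Module.End.mul_apply, Module.End.mul_apply, ih, LieAlgebra.ad_apply,
      LieAlgebra.ad_apply, exp_adL_lie]

/-- Conjugation by `exp (t ad y)`, which preserves `H`, turns powers of `ad x` into powers of `ad
x'` with `x' ∈ H`; differentiating in `t` gives the claim. -/
theorem coad_mem_nilpotentPart (hc : IsClosed (H : Set L)) {y : L} (hy : y ∈ H)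
    {f : StrongDual ℂ L} (hf : f ∈ nilpotentPart H) : coad L y f ∈ nilpotentPart H := by
  refine ⟨coad_mem_annihilator hy hf.1, fun x hx z => ?_⟩
  rw [coad_apply, neg_eq_zero, ← adL_apply]
  refine apply_mem_of_exp_mem (C := LinearMap.ker (f : L →ₗ[ℂ] ℂ)) (adL L y) f.isClosed_ker
    fun t => ?_
  rw [← map_smul, exp_adL_ad_pow]
  exact hf.2 _ (exp_apply_mem (C := H.toSubmodule) _ hc
    (fun v hv => H.lie_mem (H.smul_mem t hy) hv) hx) _

/-- Otherwise Engel's theorem gives a nonzero functional fixed by `H`, and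
`hasFiniteCodimIdeal_of_invariant` applies. -/
theorem nilpotentPart_eq_bot (hc : IsClosed (H : Set L)) (hH : IsCoatom H)
    [FiniteDimensional ℂ (L ⧸ H.toSubmodule)] (hL : ¬ HasFiniteCodimIdeal L) :
    nilpotentPart H = ⊥ := by
  by_contra hne
  have := Submodule.nontrivial_iff_ne_bot.mpr hne
  have : FiniteDimensional ℂ (nilpotentPart H) :=
    Submodule.finiteDimensional_of_le (fun f hf => hf.1 : nilpotentPart H ≤ annihilator H)
  let φ : H →ₗ[ℂ] Module.End ℂ (nilpotentPart H) :=
    { toFun x := (coad L x).restrict (p := nilpotentPart H) (q := nilpotentPart H)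
        fun f hf => coad_mem_nilpotentPart hc x.2 hf
      map_add' x y := by ext; simp
      map_smul' c x := by ext; simp }
  have hpow : ∀ (x : H) (n : ℕ) (f : nilpotentPart H),
      ((φ x ^ n) f : StrongDual ℂ L) = (coad L x ^ n) f := fun x n => by
    induction n with
    | zero => exact fun f => rfl
    | succ n ih =>
      intro f
      rw [pow_succ, pow_succ, Module.End.mul_apply, Module.End.mul_apply, ih]
      rfl
  have hφ : ∀ x y f, φ x (φ y f) = φ y (φ x f) + φ ⁅x, y⁆ f := fun x y f =>
    Subtype.ext (coad_coad (x : L) (y : L) (f : StrongDual ℂ L))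
  obtain ⟨f, hf0, hf⟩ := exists_ne_zero_of_forall_isNilpotent (H := H)
    (V := nilpotentPart H) φ hφ fun x => by
    refine ⟨Module.finrank ℂ (L ⧸ H.toSubmodule), LinearMap.ext fun f => Subtype.ext ?_⟩
    rw [hpow]
    ext z
    rw [coad_pow_apply, f.2.2 x x.2, mul_zero]
    rfl
  exact hL (hasFiniteCodimIdeal_of_invariant hc hH f.2.1 (fun h => hf0 (Subtype.ext h))
    fun x hx => congrArg Subtype.val (hf ⟨x, hx⟩))

/-- Elements which, modulo `H`, are generalized eigenvectors of some `ad x`, `x ∈ H`, with nonzero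
eigenvalue. -/
def weightVectors {𝔤 : Type*} [LieRing 𝔤] [LieAlgebra ℂ 𝔤] (H : LieSubalgebra ℂ 𝔤) : Set 𝔤 :=
  {v | ∃ x ∈ H, ∃ c : ℂ, c ≠ 0 ∧ ∃ p : ℕ,
    ((LieAlgebra.ad ℂ 𝔤 x - c • (1 : Module.End ℂ 𝔤)) ^ p) v ∈ H}

/-- A functional killing `H` and all weight vectors sees only the generalized `0`-eigenspace of each
`ad x` on `L ⧸ H`, so it lies in the nilpotent part. -/
theorem sup_span_weightVectors_eq_top (hc : IsClosed (H : Set L))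
    [FiniteDimensional ℂ (L ⧸ H.toSubmodule)] (hE : nilpotentPart H = ⊥) :
    H.toSubmodule ⊔ Submodule.span ℂ (weightVectors H) = ⊤ := by
  by_contra hne
  obtain ⟨φ, hφ0, hφ⟩ := Submodule.exists_le_ker_of_lt_top _ (lt_top_iff_ne_top.mpr hne)
  let f : StrongDual ℂ L := ⟨φ, continuous_of_le_ker hc φ (le_sup_left.trans hφ)⟩
  have hfH : f ∈ annihilator H := fun x hx => hφ (Submodule.mem_sup_left hx)
  have hfS : ∀ v ∈ weightVectors H, f v = 0 := fun v hv =>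
    hφ (Submodule.mem_sup_right (Submodule.subset_span hv))
  have hf : f ∈ nilpotentPart H := by
    refine ⟨hfH, fun x hx z => ?_⟩
    have hA : H.toSubmodule ≤ H.toSubmodule.comap (LieAlgebra.ad ℂ L x) :=
      fun v hv => H.lie_mem hx hv
    set N := Module.finrank ℂ (L ⧸ H.toSubmodule)
    set D : Module.End ℂ (L ⧸ H.toSubmodule) := H.toSubmodule.mapQ H.toSubmodule (LieAlgebra.ad ℂ L x) hA with hD
    have key : ∀ q : L ⧸ H.toSubmodule, annihilatorToDual H ⟨f, hfH⟩ ((D ^ N) q) = 0 := by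
      intro q
      have hq : q ∈ ⨆ μ, D.maxGenEigenspace μ := by
        rw [Module.End.iSup_maxGenEigenspace_eq_top]; trivial
      induction hq using Submodule.iSup_induction' with
      | zero => simp
      | add a b _ _ ha hb => rw [map_add, map_add, ha, hb, add_zero]
      | mem μ q hq =>
        rcases eq_or_ne μ 0 with rfl | hμ
        · rw [Module.End.maxGenEigenspace_eq_genEigenspace_finrank, Module.End.mem_genEigenspace_nat,
            zero_smul, sub_zero, LinearMap.mem_ker] at hq
          rw [hq, map_zero]
        · have hq' : (D ^ N) q ∈ D.maxGenEigenspace μ :=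
            Module.End.mapsTo_maxGenEigenspace_of_comm ((Commute.refl D).pow_right N) μ hq
          obtain ⟨v, hv⟩ := Submodule.Quotient.mk_surjective _ ((D ^ N) q)
          rw [← hv] at hq' ⊢
          obtain ⟨p, hp⟩ := (Module.End.mem_maxGenEigenspace D μ _).mp hq'
          rw [hD, mapQ_sub_smul_pow_mk, Submodule.Quotient.mk_eq_zero] at hp
          exact hfS v ⟨x, hx, μ, hμ, p, hp⟩
    have h1 := mapQ_sub_smul_pow_mk hA 0 N z
    rw [zero_smul, zero_smul, sub_zero, sub_zero] at h1
    have h2 := key (Submodule.Quotient.mk z)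
    rw [hD, h1] at h2
    exact h2
  rw [hE, Submodule.mem_bot] at hf
  exact hφ0 (LinearMap.ext fun z => congrArg (fun g : StrongDual ℂ L => g z) hf)

end Subalgebra

/-! ### The filtration generated by an invariant subspace -/

section Filtration

variable {𝔤 X : Type*} [LieRing 𝔤] [LieAlgebra ℂ 𝔤] [AddCommGroup X] [Module ℂ X]

/-- `filtration ρ W m` is spanned by the `ρ y₁ ⋯ ρ yₖ f` with `f ∈ W` and `k < m`. -/
def filtration (ρ : 𝔤 →ₗ[ℂ] Module.End ℂ X) (W : Submodule ℂ X) : ℕ → Submodule ℂ X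
  | 0 => ⊥
  | m + 1 => W ⊔ filtration ρ W m ⊔ Submodule.map₂ ρ ⊤ (filtration ρ W m)

variable {ρ : 𝔤 →ₗ[ℂ] Module.End ℂ X} {H : LieSubalgebra ℂ 𝔤} {W : Submodule ℂ X}

theorem filtration_one : filtration ρ W 1 = W := by
  simp [filtration]

theorem filtration_monotone : Monotone (filtration ρ W) :=
  monotone_nat_of_le_succ fun _ => le_sup_right.trans le_sup_left

theorem apply_mem_filtration_succ (y : 𝔤) {m : ℕ} {g : X} (hg : g ∈ filtration ρ W m) :
    ρ y g ∈ filtration ρ W (m + 1) :=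
  Submodule.mem_sup_right (Submodule.apply_mem_map₂ ρ trivial hg)

theorem filtration_succ_le {m : ℕ} {P : Submodule ℂ X} (hW : W ≤ P) (hm : filtration ρ W m ≤ P)
    (h : ∀ y, ∀ g ∈ filtration ρ W m, ρ y g ∈ P) : filtration ρ W (m + 1) ≤ P :=
  sup_le (sup_le hW hm) (Submodule.map₂_le.mpr fun y _ g hg => h y g hg)

theorem apply_mem_filtration (hρ : ∀ x y f, ρ x (ρ y f) = ρ y (ρ x f) + ρ ⁅x, y⁆ f)
    (hW : ∀ x ∈ H, ∀ f ∈ W, ρ x f ∈ W) {x : 𝔤} (hx : x ∈ H) {m : ℕ} {g : X}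
    (hg : g ∈ filtration ρ W m) : ρ x g ∈ filtration ρ W m := by
  induction m generalizing g with
  | zero =>
    have : g = 0 := hg
    rw [this, map_zero]
    exact zero_mem _
  | succ m ih =>
    have h : filtration ρ W (m + 1) ≤ (filtration ρ W (m + 1)).comap (ρ x) := by
      refine filtration_succ_le ?_ ?_ ?_
      · exact fun f hf => Submodule.mem_sup_left (Submodule.mem_sup_left (hW x hx f hf))
      · exact fun f hf => filtration_monotone m.le_succ (ih hf)
      · intro y f hf
        rw [Submodule.mem_comap, hρ]
        exact add_mem (apply_mem_filtration_succ y (ih hf)) (apply_mem_filtration_succ _ hf)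
    exact h hg

/-- Weights add, modulo the previous filtration step. By the Leibniz rule each factor of `ρ x - (b +
a)` lowers either `p` or `q`; once `p = 0` the vector is in `H`, which preserves the filtration, and
once `q = 0` the argument `g` has dropped a step. -/
theorem weight_add (hρ : ∀ x y f, ρ x (ρ y f) = ρ y (ρ x f) + ρ ⁅x, y⁆ f)
    (hW : ∀ x ∈ H, ∀ f ∈ W, ρ x f ∈ W) {x : 𝔤} (hx : x ∈ H) {a b : ℂ} {m : ℕ}
    (p q : ℕ) {v : 𝔤} (hv : ((LieAlgebra.ad ℂ 𝔤 x - a • (1 : Module.End ℂ 𝔤)) ^ p) v ∈ H)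
    {g : X} (hg : g ∈ filtration ρ W (m + 1))
    (hg' : ((ρ x - b • (1 : Module.End ℂ X)) ^ q) g ∈ filtration ρ W m) :
    ((ρ x - (b + a) • (1 : Module.End ℂ X)) ^ (p + q)) (ρ v g) ∈ filtration ρ W (m + 1) := by
  have hstab : ∀ (c : ℂ) (n k : ℕ), ∀ f ∈ filtration ρ W k,
      ((ρ x - c • (1 : Module.End ℂ X)) ^ n) f ∈ filtration ρ W k := by
    intro c n k
    induction n with
    | zero => exact fun f hf => hf
    | succ n ih =>
      intro f hf
      rw [pow_succ, Module.End.mul_apply]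
      exact ih _ (sub_mem (apply_mem_filtration hρ hW hx hf) (Submodule.smul_mem _ c hf))
  induction hn : p + q generalizing p q v g with
  | zero =>
    obtain ⟨rfl, rfl⟩ : p = 0 ∧ q = 0 := by omega
    exact apply_mem_filtration hρ hW hv hg
  | succ n ih =>
    rcases p with _ | p
    · exact hstab _ _ _ _ (apply_mem_filtration hρ hW hv hg)
    rcases q with _ | q
    · exact hstab _ _ _ _ (apply_mem_filtration_succ v hg')
    have hsplit : (ρ x - (b + a) • (1 : Module.End ℂ X)) (ρ v g) =
        ρ ((LieAlgebra.ad ℂ 𝔤 x - a • (1 : Module.End ℂ 𝔤)) v) g +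
          ρ v ((ρ x - b • (1 : Module.End ℂ X)) g) := by
      simp only [LinearMap.sub_apply, LinearMap.smul_apply, Module.End.one_apply, hρ x v g,
        LieAlgebra.ad_apply, map_sub, map_smul, add_smul, LinearMap.add_apply]
      abel
    rw [pow_succ, Module.End.mul_apply, hsplit, map_add]
    refine add_mem (ih p (q + 1) ?_ hg hg' (by omega)) (ih (p + 1) q hv ?_ ?_ (by omega))
    · rwa [pow_succ, Module.End.mul_apply] at hv
    · simpa using hstab b 1 _ g hg
    · rwa [pow_succ, Module.End.mul_apply] at hg'

theorem pow_apply_mem_filtration_succ (v : 𝔤) (k : ℕ) {m : ℕ} {g : X}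
    (hg : g ∈ filtration ρ W m) : (ρ v ^ k) g ∈ filtration ρ W (m + k) := by
  induction k with
  | zero => exact hg
  | succ k ih =>
    rw [pow_succ', Module.End.mul_apply]
    exact apply_mem_filtration_succ v ih

/-- The weights of `ρ x`, `x ∈ H`, are bounded, so a weight vector of nonzero weight acts
nilpotently on the associated graded space. -/
theorem exists_pow_apply_mem_filtration (hρ : ∀ x y f, ρ x (ρ y f) = ρ y (ρ x f) + ρ ⁅x, y⁆ f)
    (hW : ∀ x ∈ H, ∀ f ∈ W, ρ x f ∈ W) [FiniteDimensional ℂ W]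
    (hfin : ∀ m, FiniteDimensional ℂ (filtration ρ W m))
    (hbound : ∀ x ∈ H, ∃ R : ℝ, ∀ c : ℂ, R < ‖c‖ →
      Function.Injective (ρ x - c • (1 : Module.End ℂ X)))
    {v : 𝔤} (hv : v ∈ weightVectors H) :
    ∃ j, ∀ k ≥ j, ∀ f ∈ W, (ρ v ^ k) f ∈ filtration ρ W k := by
  obtain ⟨x, hx, a, ha, p, hp⟩ := hv
  obtain ⟨R, hR⟩ := hbound x hx
  obtain ⟨j, hj⟩ := exists_nat_gt ((2 * R) / ‖a‖)
  -- No weight of modulus above `R` survives in any quotient by a filtration step.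
  have hdesc : ∀ (c : ℂ) (m n : ℕ) (g : X), R < ‖c‖ →
      ((ρ x - c • (1 : Module.End ℂ X)) ^ n) g ∈ filtration ρ W m → g ∈ filtration ρ W m :=
    fun c m n g hc hg => mem_of_pow_apply_mem (hR c hc) (fun f hf =>
      sub_mem (apply_mem_filtration hρ hW hx hf) (Submodule.smul_mem _ c hf)) n hg
  refine ⟨j, fun k hk f hf => ?_⟩
  set T : Module.End ℂ W := (ρ x).restrict (hW x hx)
  have hTpow : ∀ (c : ℂ) (n : ℕ) (g : W), (((T - c • (1 : Module.End ℂ W)) ^ n) g : X) =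
      ((ρ x - c • (1 : Module.End ℂ X)) ^ n) g := by
    intro c n
    induction n with
    | zero => exact fun g => rfl
    | succ n ih =>
      intro g
      rw [pow_succ, pow_succ, Module.End.mul_apply, Module.End.mul_apply, ih]
      rfl
  have hmem : (⟨f, hf⟩ : W) ∈ ⨆ μ, Module.End.maxGenEigenspace T μ := by
    rw [Module.End.iSup_maxGenEigenspace_eq_top]; trivial
  suffices h : ∀ g : W, g ∈ ⨆ μ, Module.End.maxGenEigenspace T μ →
      (ρ v ^ k) (g : X) ∈ filtration ρ W k from h _ hmem
  intro g hg
  induction hg using Submodule.iSup_induction' with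
  | zero => simp
  | add g g' _ _ h h' => rw [Submodule.coe_add, map_add]; exact add_mem h h'
  | mem b g hg =>
    obtain ⟨q, hq⟩ := (Module.End.mem_maxGenEigenspace T b g).mp hg
    have hq' : ((ρ x - b • (1 : Module.End ℂ X)) ^ q) (g : X) = 0 := by
      rw [← hTpow, hq, Submodule.coe_zero]
    by_cases hb : R < ‖b‖
    · have : (g : X) ∈ filtration ρ W 0 := hdesc b 0 q g hb (by rw [hq']; exact zero_mem _)
      have h0 : (g : X) = 0 := this
      rw [h0, map_zero]
      exact zero_mem _
    · have hstep : ∀ i : ℕ, ∃ n, ((ρ x - (b + i * a) • (1 : Module.End ℂ X)) ^ n)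
          ((ρ v ^ i) (g : X)) ∈ filtration ρ W i := by
        intro i
        induction i with
        | zero =>
          refine ⟨q, ?_⟩
          rw [Nat.cast_zero, zero_mul, add_zero, pow_zero, Module.End.one_apply, hq']
          exact zero_mem _
        | succ i ih =>
          obtain ⟨n, hn⟩ := ih
          have hgi : (ρ v ^ i) (g : X) ∈ filtration ρ W (i + 1) := by
            rw [add_comm i 1]
            exact pow_apply_mem_filtration_succ v i (filtration_one.ge g.2)
          refine ⟨p + n, ?_⟩
          have := weight_add hρ hW hx p n hp hgi hn
          rw [pow_succ' (ρ v), Module.End.mul_apply, Nat.cast_succ, add_mul, one_mul, ← add_assoc]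
          exact this
      obtain ⟨n, hn⟩ := hstep k
      -- Here `‖b‖ ≤ R` and `k‖a‖ > 2R`, so `‖b + k a‖ > R`.
      refine hdesc (b + k * a) k n _ ?_ hn
      have ha' : 0 < ‖a‖ := norm_pos_iff.mpr ha
      have h1 : 2 * R < j * ‖a‖ := (div_lt_iff₀ ha').mp hj
      have h2 : (j : ℝ) * ‖a‖ ≤ k * ‖a‖ :=
        mul_le_mul_of_nonneg_right (by exact_mod_cast hk) ha'.le
      have h3 : ‖(k : ℂ) * a‖ ≤ ‖b + k * a‖ + ‖b‖ := by
        have := norm_sub_le (b + k * a) b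
        rwa [add_sub_cancel_left] at this
      rw [norm_mul, Complex.norm_natCast] at h3
      linarith [not_lt.mp hb]

/-- The product of the operators `ρ y`, for `y` in a list. -/
def word (ρ : 𝔤 →ₗ[ℂ] Module.End ℂ X) (l : List 𝔤) : Module.End ℂ X := (l.map ρ).prod

theorem word_cons (y : 𝔤) (l : List 𝔤) (f : X) : word ρ (y :: l) f = ρ y (word ρ l f) := by
  simp [word]

theorem word_append (l l' : List 𝔤) (f : X) : word ρ (l ++ l') f = word ρ l (word ρ l' f) := by
  simp [word]

theorem word_replicate (n : ℕ) (v : 𝔤) (f : X) : word ρ (List.replicate n v) f = (ρ v ^ n) f := by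
  simp [word]

theorem word_apply_mem (l : List 𝔤) {m : ℕ} {g : X} (hg : g ∈ filtration ρ W m) :
    word ρ l g ∈ filtration ρ W (m + l.length) := by
  induction l with
  | nil => exact hg
  | cons y l ih => rw [word_cons]; exact apply_mem_filtration_succ y ih

/-- Swapping two neighbours costs a commutator, hence a word shorter by one letter. -/
theorem word_sub_word_mem (hρ : ∀ x y f, ρ x (ρ y f) = ρ y (ρ x f) + ρ ⁅x, y⁆ f)
    {l l' : List 𝔤} (h : l.Perm l') {f : X} (hf : f ∈ W) :
    word ρ l f - word ρ l' f ∈ filtration ρ W l.length := by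
  induction h with
  | nil => simp
  | cons y _ ih =>
    rw [word_cons, word_cons, ← map_sub]
    exact apply_mem_filtration_succ y ih
  | swap y z l =>
    rw [word_cons, word_cons, word_cons, word_cons, hρ z y, add_sub_cancel_left]
    have := apply_mem_filtration_succ ⁅z, y⁆ (word_apply_mem l (filtration_one (ρ := ρ).ge hf))
    rwa [add_comm 1] at this
  | trans h₁ _ ih₁ ih₂ =>
    rw [← h₁.length_eq] at ih₂
    have := add_mem ih₁ ih₂
    rwa [sub_add_sub_cancel] at this

/-- Letters from `H` do not raise the filtration, so only letters from `s` contribute to the top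
degree. -/
theorem filtration_succ_le_sup_span (hρ : ∀ x y f, ρ x (ρ y f) = ρ y (ρ x f) + ρ ⁅x, y⁆ f)
    (hW : ∀ x ∈ H, ∀ f ∈ W, ρ x f ∈ W) {s : Finset 𝔤}
    (hs : H.toSubmodule ⊔ Submodule.span ℂ (s : Set 𝔤) = ⊤) (m : ℕ) :
    filtration ρ W (m + 1) ≤ filtration ρ W m ⊔ Submodule.span ℂ
      {g | ∃ l : List 𝔤, l.length = m ∧ (∀ y ∈ l, y ∈ s) ∧ ∃ f ∈ W, word ρ l f = g} := by
  have hWmem : ∀ m, W ≤ filtration ρ W (m + 1) := fun m => le_sup_left.trans le_sup_left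
  induction m with
  | zero =>
    rw [zero_add, filtration_one]
    exact fun f hf => Submodule.mem_sup_right
      (Submodule.subset_span ⟨[], rfl, by simp, f, hf, by simp [word]⟩)
  | succ m ih =>
    set P := filtration ρ W (m + 1) ⊔ Submodule.span ℂ
      {g | ∃ l : List 𝔤, l.length = m + 1 ∧ (∀ y ∈ l, y ∈ s) ∧ ∃ f ∈ W, word ρ l f = g}
    refine filtration_succ_le ((hWmem m).trans le_sup_left) le_sup_left fun y g hg => ?_
    have hy : y ∈ H.toSubmodule ⊔ Submodule.span ℂ (s : Set 𝔤) := hs ▸ Submodule.mem_top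
    have hle : H.toSubmodule ⊔ Submodule.span ℂ (s : Set 𝔤) ≤ P.comap (ρ.flip g) := by
      refine sup_le ?_ (Submodule.span_le.mpr ?_)
      · exact fun x hx => Submodule.mem_sup_left (apply_mem_filtration hρ hW hx hg)
      · intro v hv
        have hle' : filtration ρ W m ⊔ Submodule.span ℂ
            {g | ∃ l : List 𝔤, l.length = m ∧ (∀ y ∈ l, y ∈ s) ∧ ∃ f ∈ W, word ρ l f = g} ≤
            P.comap (ρ v) := by
          refine sup_le ?_ (Submodule.span_le.mpr ?_)
          · exact fun f hf => Submodule.mem_sup_left (apply_mem_filtration_succ v hf)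
          · rintro _ ⟨l, hl, hls, f, hf, rfl⟩
            refine Submodule.mem_sup_right (Submodule.subset_span
              ⟨v :: l, by simp [hl], ?_, f, hf, word_cons v l f⟩)
            simpa using ⟨hv, hls⟩
        exact hle' (ih hg)
    exact hle hy

theorem finiteDimensional_filtration (hρ : ∀ x y f, ρ x (ρ y f) = ρ y (ρ x f) + ρ ⁅x, y⁆ f)
    (hW : ∀ x ∈ H, ∀ f ∈ W, ρ x f ∈ W) [FiniteDimensional ℂ W] {s : Finset 𝔤}
    (hs : H.toSubmodule ⊔ Submodule.span ℂ (s : Set 𝔤) = ⊤) (m : ℕ) :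
    FiniteDimensional ℂ (filtration ρ W m) := by
  induction m with
  | zero => exact inferInstanceAs (FiniteDimensional ℂ (⊥ : Submodule ℂ X))
  | succ m ih =>
    have hle : filtration ρ W (m + 1) ≤
        W ⊔ filtration ρ W m ⊔ s.sup fun v => (filtration ρ W m).map (ρ v) := by
      refine filtration_succ_le (le_sup_left.trans le_sup_left) (le_sup_right.trans le_sup_left)
        fun y g hg => ?_
      have hy : y ∈ H.toSubmodule ⊔ Submodule.span ℂ (s : Set 𝔤) := hs ▸ Submodule.mem_top
      have hle : H.toSubmodule ⊔ Submodule.span ℂ (s : Set 𝔤) ≤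
          (W ⊔ filtration ρ W m ⊔ s.sup fun v => (filtration ρ W m).map (ρ v)).comap
            (ρ.flip g) := by
        refine sup_le ?_ (Submodule.span_le.mpr ?_)
        · exact fun x hx => Submodule.mem_sup_left
            (Submodule.mem_sup_right (apply_mem_filtration hρ hW hx hg))
        · exact fun v hv => Submodule.mem_sup_right
            (Finset.le_sup (f := fun v => (filtration ρ W m).map (ρ v)) hv
              (Submodule.mem_map_of_mem hg))
      exact hle hy
    have := Submodule.finite_finset_sup s fun v => (filtration ρ W m).map (ρ v)
    exact Submodule.finiteDimensional_of_le hle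

/-- The filtration stabilizes. -/
theorem exists_filtration_succ_le (hρ : ∀ x y f, ρ x (ρ y f) = ρ y (ρ x f) + ρ ⁅x, y⁆ f)
    (hW : ∀ x ∈ H, ∀ f ∈ W, ρ x f ∈ W) [FiniteDimensional ℂ W]
    (hbound : ∀ x ∈ H, ∃ R : ℝ, ∀ c : ℂ, R < ‖c‖ →
      Function.Injective (ρ x - c • (1 : Module.End ℂ X)))
    {s : Finset 𝔤} (hsw : (s : Set 𝔤) ⊆ weightVectors H)
    (hs : H.toSubmodule ⊔ Submodule.span ℂ (s : Set 𝔤) = ⊤) :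
    ∃ m, FiniteDimensional ℂ (filtration ρ W (m + 1)) ∧
      filtration ρ W (m + 2) ≤ filtration ρ W (m + 1) := by
  classical
  have hfin := finiteDimensional_filtration hρ hW hs
  choose! j hj using fun v (hv : v ∈ s) =>
    exists_pow_apply_mem_filtration hρ hW hfin hbound (hsw hv)
  set k := s.sup j
  -- A word of length `s.card * k + 1` must repeat some letter at least `k` times.
  refine ⟨s.card * k, hfin _, ?_⟩
  refine (filtration_succ_le_sup_span hρ hW hs (s.card * k + 1)).trans
    (sup_le le_rfl (Submodule.span_le.mpr ?_))
  rintro _ ⟨l, hl, hls, f, hf, rfl⟩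
  obtain ⟨v, hv, hvk⟩ : ∃ v ∈ s, k ≤ l.count v := by
    by_contra! hlt
    have h1 : l.length ≤ l.toFinset.card * k := by
      rw [← List.sum_toFinset_count_eq_length l, ← smul_eq_mul]
      exact Finset.sum_le_card_nsmul _ _ _ fun v hv =>
        (hlt v (hls v (List.mem_toFinset.mp hv))).le
    have h2 : l.toFinset.card ≤ s.card :=
      Finset.card_le_card fun v hv => hls v (List.mem_toFinset.mp hv)
    have h3 := Nat.mul_le_mul_right k h2
    omega
  -- Move `k` copies of `v` to the right end, where they act first on `f` and lose one filtration
  -- step.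
  obtain ⟨l', hl'⟩ := (List.replicate_sublist_iff.mpr hvk).exists_perm_append
  have hperm : l.Perm (l' ++ List.replicate k v) := hl'.trans List.perm_append_comm
  have hlen := hperm.length_eq
  rw [List.length_append, List.length_replicate] at hlen
  have h1 := word_sub_word_mem hρ hperm hf
  have h2 : word ρ (l' ++ List.replicate k v) f ∈ filtration ρ W (k + l'.length) := by
    rw [word_append, word_replicate]
    exact word_apply_mem l' (hj v hv k (Finset.le_sup hv) f hf)
  rw [add_comm, ← hlen] at h2
  have h3 := add_mem h1 h2
  rw [sub_add_cancel, hl] at h3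
  exact h3

end Filtration

/-! ### Ideals of finite codimension from subalgebras of finite codimension -/

theorem exists_finset_sup_span_eq_top {X : Type*} [AddCommGroup X] [Module ℂ X]
    {P : Submodule ℂ X} [FiniteDimensional ℂ (X ⧸ P)] {S : Set X}
    (h : P ⊔ Submodule.span ℂ S = ⊤) :
    ∃ s : Finset X, (s : Set X) ⊆ S ∧ P ⊔ Submodule.span ℂ (s : Set X) = ⊤ := by
  classical
  obtain ⟨t, ht, -, hspan, -⟩ :=
    Submodule.exists_finset_span_eq_linearIndepOn ℂ (P.mkQ '' S)
  obtain ⟨s, hs, rfl⟩ := Finset.subset_set_image_iff.mp ht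
  refine ⟨s, hs, ?_⟩
  rw [← Submodule.comap_map_mkQ, Submodule.map_span, ← Finset.coe_image, hspan,
    ← Submodule.map_span, Submodule.comap_map_mkQ, h]

theorem finiteDimensional_quotient_of_le {X : Type*} [AddCommGroup X] [Module ℂ X]
    {P Q : Submodule ℂ X} [FiniteDimensional ℂ (X ⧸ P)] (h : P ≤ Q) :
    FiniteDimensional ℂ (X ⧸ Q) :=
  Module.Finite.of_surjective (Submodule.factor h) (Submodule.factor_surjective h)

theorem finiteDimensional_quotient_of_forall {X D : Type*} [AddCommGroup X] [Module ℂ X]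
    [AddCommGroup D] [Module ℂ D] (b : D →ₗ[ℂ] X →ₗ[ℂ] ℂ) (F : Submodule ℂ D)
    [FiniteDimensional ℂ F] (I : Submodule ℂ X)
    (hI : ∀ y, (∀ f ∈ F, b f y = 0) → y ∈ I) : FiniteDimensional ℂ (X ⧸ I) := by
  let ev : X →ₗ[ℂ] Module.Dual ℂ F := (b ∘ₗ F.subtype).flip
  have : FiniteDimensional ℂ (X ⧸ LinearMap.ker ev) :=
    Module.Finite.equiv ev.quotKerEquivRange.symm
  refine finiteDimensional_quotient_of_le (P := LinearMap.ker ev) fun y hy => hI y fun f hf => ?_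
  exact congrArg (fun φ : Module.Dual ℂ F => φ ⟨f, hf⟩) (LinearMap.mem_ker.mp hy)

/-- Subalgebras above `H` correspond to subspaces of the finite-dimensional quotient, where
ascending chains stop. -/
theorem exists_isCoatom_ge {𝔤 : Type*} [LieRing 𝔤] [LieAlgebra ℂ 𝔤] {H : LieSubalgebra ℂ 𝔤}
    (hH : H ≠ ⊤) [FiniteDimensional ℂ (𝔤 ⧸ H.toSubmodule)] :
    ∃ T : LieSubalgebra ℂ 𝔤, H ≤ T ∧ IsCoatom T := by
  let P := H.toSubmodule
  let 𝒮 : Set (Submodule ℂ (𝔤 ⧸ P)) :=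
    {N | ∃ T : LieSubalgebra ℂ 𝔤, T ≠ ⊤ ∧ H ≤ T ∧ T.toSubmodule.map P.mkQ = N}
  obtain ⟨N, ⟨T, hT, hHT, rfl⟩, hmax⟩ :=
    (wellFounded_gt (α := Submodule ℂ (𝔤 ⧸ P))).has_min 𝒮 ⟨_, H, hH, le_rfl, rfl⟩
  refine ⟨T, hHT, hT, fun T' hTT' => ?_⟩
  by_contra hT'
  have hHT' : H ≤ T' := hHT.trans hTT'.le
  refine hmax _ ⟨T', hT', hHT', rfl⟩ (lt_of_le_of_ne (Submodule.map_mono hTT'.le) fun heq => ?_)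
  have hcomap := congrArg (Submodule.comap P.mkQ) heq
  rw [Submodule.comap_map_mkQ, Submodule.comap_map_mkQ, sup_of_le_right (b := T.toSubmodule) hHT,
    sup_of_le_right (b := T'.toSubmodule) hHT'] at hcomap
  exact hTT'.ne (LieSubalgebra.toSubmodule_injective hcomap)

theorem hasFiniteCodimIdeal_of_isCoatom {H : LieSubalgebra ℂ L} (hc : IsClosed (H : Set L))
    (hH : IsCoatom H) [FiniteDimensional ℂ (L ⧸ H.toSubmodule)] : HasFiniteCodimIdeal L := by
  by_contra hL
  have hE := nilpotentPart_eq_bot hc hH hL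
  obtain ⟨s, hsw, hs⟩ :=
    exists_finset_sup_span_eq_top (sup_span_weightVectors_eq_top hc hE)
  obtain ⟨m, hfin, hm⟩ := exists_filtration_succ_le (ρ := coad L) (W := annihilator H)
    coad_coad (fun x hx f hf => coad_mem_annihilator hx hf)
    (fun x _ => ⟨‖adL L x‖, fun c hc => coad_sub_smul_injective hc⟩) hsw hs
  set F := filtration (coad L) (annihilator H) (m + 1)
  -- The index is at least one, so `F` contains every functional vanishing on `H`; as `H` is proper,
  -- this makes the common kernel `I` proper.
  have hWF : annihilator H ≤ F := le_sup_left.trans le_sup_left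
  let I : LieIdeal ℂ L :=
    { carrier := {y | ∀ f ∈ F, f y = 0}
      add_mem' := fun {a b} ha hb f hf => by rw [map_add, ha f hf, hb f hf, add_zero]
      zero_mem' := fun f _ => map_zero f
      smul_mem' := fun c y hy f hf => by rw [map_smul, hy f hf, smul_zero]
      lie_mem := fun {y z} hz f hf => by
        have h := hz _ (hm (apply_mem_filtration_succ y hf))
        rwa [coad_apply, neg_eq_zero] at h }
  refine hL ⟨I, ?_, ?_, ?_⟩
  · have : (I : Set L) = ⋂ f ∈ F, {y | f y = 0} := by
      ext y
      simp only [Set.mem_iInter]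
      rfl
    rw [this]
    exact isClosed_biInter fun f _ => isClosed_eq f.continuous continuous_const
  · intro htop
    have hWbot : ∀ f ∈ annihilator H, f = 0 := fun f hf => ContinuousLinearMap.ext fun y =>
      (htop ▸ LieSubmodule.mem_top y : y ∈ I) f (hWF hf)
    have hlt : H.toSubmodule < ⊤ :=
      lt_top_iff_ne_top.mpr fun h => hH.1 (LieSubalgebra.toSubmodule_injective h)
    obtain ⟨φ, hφ0, hφ⟩ := Submodule.exists_le_ker_of_lt_top _ hlt
    have h0 := hWbot ⟨φ, continuous_of_le_ker hc φ hφ⟩ fun x hx => hφ hx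
    exact hφ0 (LinearMap.ext fun z => congrArg (fun g : StrongDual ℂ L => g z) h0)
  · exact finiteDimensional_quotient_of_forall (ContinuousLinearMap.coeLM ℂ) F I.toSubmodule fun y hy => hy

/-- A Banach Lie algebra with a proper closed subalgebra of finite codimension has a proper
closed ideal of finite codimension. -/
theorem hasFiniteCodimIdeal_of_subalgebra {H : LieSubalgebra ℂ L} (hc : IsClosed (H : Set L))
    (hH : H ≠ ⊤) [FiniteDimensional ℂ (L ⧸ H.toSubmodule)] : HasFiniteCodimIdeal L := by
  obtain ⟨T, hHT, hT⟩ := exists_isCoatom_ge hH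
  have : FiniteDimensional ℂ (L ⧸ T.toSubmodule) :=
    finiteDimensional_quotient_of_le (P := H.toSubmodule) hHT
  exact hasFiniteCodimIdeal_of_isCoatom
    (Submodule.isClosed_mono_of_finiteDimensional_quotient (s := H.toSubmodule)
      (t := T.toSubmodule) hc hHT) hT

/-- A closed subalgebra of a Banach Lie algebra is a Banach Lie algebra. -/
@[reducible]
noncomputable def closedSubalgebraBanachLieAlgebra (M : LieSubalgebra ℂ L)
    (hM : IsClosed (M : Set L)) : BanachLieAlgebra M :=
  { (inferInstance : NormedAddCommGroup M.toSubmodule),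
    (inferInstance : LieRing M),
    (inferInstance : NormedSpace ℂ M.toSubmodule),
    (inferInstance : LieAlgebra ℂ M),
    (hM.completeSpace_coe : CompleteSpace M) with
    exists_multiplication_constant := by
      obtain ⟨t, ht, h⟩ := BanachLieAlgebra.exists_multiplication_constant (L := L)
      exact ⟨t, ht, fun a b => h a b⟩ }

theorem idealPreradicalOf_ne_self {M : LieSubalgebra ℂ L} (hM : IsClosed (M : Set L))
    {H : LieSubalgebra ℂ L} (hc : IsClosed (H : Set L)) (hMH : ¬ M ≤ H)
    (hfin : FiniteDimensional ℂ (M ⧸ H.toSubmodule.comap M.toSubmodule.subtype)) :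
    idealPreradicalOf L M ≠ M := by
  let _ : BanachLieAlgebra M := closedSubalgebraBanachLieAlgebra M hM
  have hne : H.comap M.incl ≠ ⊤ := fun h => hMH fun z hz =>
    (h ▸ LieSubalgebra.mem_top (⟨z, hz⟩ : M) : (⟨z, hz⟩ : M) ∈ H.comap M.incl)
  have : FiniteDimensional ℂ (M ⧸ (H.comap M.incl).toSubmodule) := hfin
  have hcl : IsClosed ((H.comap M.incl : LieSubalgebra ℂ M) : Set M) :=
    hc.preimage continuous_subtype_val
  obtain ⟨I, h1, h2, h3⟩ := hasFiniteCodimIdeal_of_subalgebra hcl hne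
  intro heq
  refine h2 (eq_top_iff.mpr fun z _ => ?_)
  obtain ⟨_, hz⟩ := mem_idealPreradicalOf.mp (heq.ge z.2)
  exact hz I h1 h2 h3

/-! ### Complete lower finite-gap chains -/

section Chains

variable {X : Type u} [NormedAddCommGroup X] [NormedSpace ℂ X]

theorem isPComplete_of_sInf_mem {G : Set (ClosedSubmodule ℂ X)}
    (h : ∀ S ⊆ G, S.Nonempty → sInf S ∈ G) (htop : ss G ∈ G) : IsPComplete G := by
  refine Set.Subset.antisymm (fun Y hY => Or.inl ⟨{Y}, Set.singleton_nonempty Y, by simpa, ?_⟩) ?_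
  · rw [pp, sInf_singleton]
  · rintro Y (⟨S, hS, hSG, rfl⟩ | hY)
    · exact h S hSG hS
    · rw [Set.mem_singleton_iff.mp hY]; exact htop

theorem isSComplete_of_sSup_mem {G : Set (ClosedSubmodule ℂ X)}
    (h : ∀ S ⊆ G, S.Nonempty → sSup S ∈ G) (hbot : pp G ∈ G) : IsSComplete G := by
  refine Set.Subset.antisymm (fun Y hY => Or.inl ⟨{Y}, Set.singleton_nonempty Y, by simpa, ?_⟩) ?_
  · rw [ss, sSup_singleton]
  · rintro Y (⟨S, hS, hSG, rfl⟩ | hY)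
    · exact h S hSG hS
    · rw [Set.mem_singleton_iff.mp hY]; exact hbot

theorem IsPComplete.sInf_mem {G : Set (ClosedSubmodule ℂ X)} (hG : IsPComplete G)
    {S : Set (ClosedSubmodule ℂ X)} (hS : S ⊆ G) (hne : S.Nonempty) : sInf S ∈ G := by
  rw [hG]
  exact Or.inl ⟨S, hne, hS, rfl⟩

theorem IsPComplete.ss_mem {G : Set (ClosedSubmodule ℂ X)} (hG : IsPComplete G) : ss G ∈ G := by
  have h : ss G ∈ pCompletion G := Or.inr rfl
  rwa [← hG] at h

/-- The transfinite iteration of `f` starting from the whole space. -/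
noncomputable def descent (f : ClosedSubmodule ℂ X → ClosedSubmodule ℂ X) (α : Ordinal.{u}) :
    ClosedSubmodule ℂ X :=
  ⨅ β : Set.Iio α, f (descent f β.1)
termination_by α
decreasing_by exact β.2

section Descent

variable {f : ClosedSubmodule ℂ X → ClosedSubmodule ℂ X}

theorem descent_le {α β : Ordinal.{u}} (h : β < α) : descent f α ≤ f (descent f β) := by
  rw [descent]
  exact iInf_le (fun β : Set.Iio α => f (descent f β.1)) ⟨β, h⟩

theorem le_descent {α : Ordinal.{u}} {T : ClosedSubmodule ℂ X}
    (h : ∀ β < α, T ≤ f (descent f β)) : T ≤ descent f α := by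
  rw [descent]
  exact le_iInf fun β => h β.1 β.2

theorem descent_antitone : Antitone (descent f) := fun _ _ h =>
  le_descent fun _ hγ => descent_le (hγ.trans_le h)

theorem descent_zero : descent f 0 = ⊤ :=
  top_le_iff.mp (le_descent fun _ h => absurd h not_lt_zero)

theorem descent_add_one (hf : ∀ Z, f Z ≤ Z) (α : Ordinal.{u}) :
    descent f (α + 1) = f (descent f α) := by
  refine le_antisymm (descent_le (Order.lt_add_one_iff.mpr le_rfl)) (le_descent fun β hβ => ?_)
  rcases (Order.lt_add_one_iff.mp hβ).lt_or_eq with h | rfl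
  · exact (hf _).trans (descent_le h)
  · exact le_rfl

theorem descent_mem {G : Set (ClosedSubmodule ℂ X)} (hG : IsPComplete G) (htop : ⊤ ∈ G)
    (hf : ∀ Z ∈ G, f Z ∈ G) (α : Ordinal.{u}) : descent f α ∈ G := by
  induction α using WellFoundedLT.induction with
  | ind α ih =>
    rcases isEmpty_or_nonempty (Set.Iio α) with h | h
    · rw [descent, iInf_of_empty]; exact htop
    · rw [descent]
      refine hG.sInf_mem ?_ (Set.range_nonempty _)
      rintro _ ⟨β, rfl⟩
      exact hf _ (ih β.1 β.2)

/-- A descent that never reaches zero would inject the ordinals of universe `u` into a type in that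
universe. -/
theorem exists_descent_eq_bot {G : Set (ClosedSubmodule ℂ X)}
    (hG : ∀ α, descent f α ∈ G) (hlt : ∀ Z ∈ G, Z ≠ ⊥ → f Z < Z) : ∃ α, descent f α = ⊥ := by
  by_contra! h
  have hs : StrictAnti (descent f) := fun α β hαβ =>
    (descent_le hαβ).trans_lt (hlt _ (hG α) (h α))
  exact not_injective_of_ordinal (descent f) hs.injective

theorem sInf_mem_range_descent (hbot : ∃ α, descent f α = ⊥) {S : Set (ClosedSubmodule ℂ X)}
    (hS : S ⊆ Set.range (descent f)) : sInf S ∈ Set.range (descent f) := by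
  have hne : {α | descent f α ≤ sInf S}.Nonempty := by
    obtain ⟨α, hα⟩ := hbot
    exact ⟨α, hα.trans_le bot_le⟩
  -- At the least index `α` with `descent f α ≤ sInf S`, each earlier term strictly contains a
  -- member of `S`, so its successor still contains `sInf S`.
  refine ⟨sInf {α | descent f α ≤ sInf S}, le_antisymm (csInf_mem hne) (le_descent fun β hβ => ?_)⟩
  have hnot : ¬ descent f β ≤ sInf S := notMem_of_lt_csInf' hβ
  obtain ⟨Y, hY, hβY⟩ : ∃ Y ∈ S, ¬ descent f β ≤ Y := by
    by_contra! hall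
    exact hnot (le_sInf hall)
  obtain ⟨γ, rfl⟩ := hS hY
  have hlt : β < γ := lt_of_not_ge fun hle => hβY (descent_antitone hle)
  exact (sInf_le hY).trans (descent_le hlt)

theorem sSup_mem_range_descent {S : Set (ClosedSubmodule ℂ X)}
    (hS : S ⊆ Set.range (descent f)) (hne : S.Nonempty) : sSup S ∈ Set.range (descent f) := by
  have hne' : {α | descent f α ∈ S}.Nonempty := by
    obtain ⟨Y, hY⟩ := hne
    obtain ⟨α, rfl⟩ := hS hY
    exact ⟨α, hY⟩
  refine ⟨sInf {α | descent f α ∈ S}, le_antisymm (le_sSup (csInf_mem hne')) (sSup_le ?_)⟩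
  intro Y hY
  obtain ⟨α, rfl⟩ := hS hY
  exact descent_antitone (csInf_le' hY)

end Descent

theorem exists_isCompleteLowerFiniteGapChain {G : Set (ClosedSubmodule ℂ X)}
    (hG : IsPComplete G) (htop : ⊤ ∈ G) (hbot : ⊥ ∈ G) (hgap : IsLowerFiniteGap G) :
    ∃ C ⊆ G, IsCompleteLowerFiniteGapChain C := by
  have hppG : pp G = ⊥ := le_bot_iff.mp (sInf_le hbot)
  have hstep : ∀ Z, ∃ Y, Y ≤ Z ∧ (Z ∈ G → Y ∈ G) ∧ (Z ∈ G → Z ≠ ⊥ → FiniteGap Y Z) := by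
    intro Z
    by_cases hZ : Z ∈ G ∧ Z ≠ ⊥
    · obtain ⟨Y, hY, hYZ⟩ := hgap Z hZ.1 (hppG ▸ hZ.2)
      exact ⟨Y, hYZ.1.le, fun _ => hY, fun _ _ => hYZ⟩
    · exact ⟨Z, le_rfl, id, fun h1 h2 => absurd ⟨h1, h2⟩ hZ⟩
  choose f hle hmem hfg using hstep
  have hd : ∀ α, descent f α ∈ G := descent_mem hG htop hmem
  obtain ⟨α₀, hα₀⟩ := exists_descent_eq_bot hd fun Z hZ h0 => (hfg Z hZ h0).1
  set C := Set.range (descent f)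
  have hpp : pp C = ⊥ := le_bot_iff.mp (sInf_le ⟨α₀, hα₀⟩)
  have hss : ss C = ⊤ := top_le_iff.mp (le_sSup ⟨0, descent_zero⟩)
  refine ⟨C, ?_, ?_, ⟨?_, ?_⟩, ?_, hpp, hss⟩
  · rintro _ ⟨α, rfl⟩
    exact hd α
  · rintro _ ⟨α, rfl⟩ _ ⟨β, rfl⟩ -
    exact (le_total β α).imp (fun h => descent_antitone h) fun h => descent_antitone h
  · exact isPComplete_of_sInf_mem (fun S hS _ => sInf_mem_range_descent ⟨α₀, hα₀⟩ hS)
      (hss ▸ ⟨0, descent_zero⟩)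
  · exact isSComplete_of_sSup_mem (fun S hS hne => sSup_mem_range_descent hS hne)
      (hpp ▸ ⟨α₀, hα₀⟩)
  · rintro _ ⟨α, rfl⟩ h0
    rw [hpp] at h0
    exact ⟨f (descent f α), ⟨α + 1, descent_add_one hle α⟩, hfg _ (hd α) h0⟩

end Chains

/-! ### Families of subalgebras and of subideals -/

section Subalgebras

theorem mem_closedSubalgebras {Y : ClosedSubmodule ℂ L} :
    Y ∈ closedSubalgebras L ↔ ∀ x ∈ Y, ∀ y ∈ Y, ⁅x, y⁆ ∈ Y := by
  constructor
  · rintro ⟨M, hM⟩ x hx y hy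
    have h : ∀ z, z ∈ Y ↔ z ∈ M := fun z => (SetLike.ext_iff.mp hM z).symm
    rw [h] at hx hy ⊢
    exact M.lie_mem hx hy
  · intro h
    exact ⟨{ Y.toSubmodule with lie_mem' := fun {x y} hx hy => h x hx y hy }, rfl⟩

theorem mem_closedTwoStepSubideals {Y : ClosedSubmodule ℂ L} :
    Y ∈ closedTwoStepSubideals L ↔
      ∃ K : LieIdeal ℂ L, (∀ y ∈ Y, y ∈ K) ∧ ∀ k ∈ K, ∀ y ∈ Y, ⁅k, y⁆ ∈ Y := by
  constructor
  · rintro ⟨K, I, hI⟩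
    have h : ∀ z, z ∈ Y ↔ ∃ w : K, w ∈ I ∧ (w : L) = z := fun z =>
      (SetLike.ext_iff.mp hI z).symm
    refine ⟨K, fun y hy => ?_, fun k hk y hy => ?_⟩
    · obtain ⟨w, -, rfl⟩ := (h y).mp hy
      exact w.2
    · obtain ⟨w, hw, rfl⟩ := (h y).mp hy
      exact (h _).mpr ⟨⁅(⟨k, hk⟩ : K), w⁆, I.lie_mem hw, rfl⟩
  · rintro ⟨K, hYK, hK⟩
    refine ⟨K, { Y.toSubmodule.comap K.toSubmodule.subtype with
      lie_mem := fun {k y} hy => hK k k.2 y hy }, ?_⟩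
    ext z
    constructor
    · rintro ⟨w, hw, rfl⟩
      exact hw
    · intro hz
      exact ⟨⟨z, hYK z hz⟩, hz, rfl⟩

theorem closedTwoStepSubideals_subset : closedTwoStepSubideals L ⊆ closedSubalgebras L := by
  intro Y hY
  obtain ⟨K, hYK, hK⟩ := mem_closedTwoStepSubideals.mp hY
  exact mem_closedSubalgebras.mpr fun x hx y hy => hK x (hYK x hx) y hy

theorem top_mem_closedTwoStepSubideals : ⊤ ∈ closedTwoStepSubideals L :=
  mem_closedTwoStepSubideals.mpr ⟨⊤, fun _ _ => trivial, fun _ _ _ _ => trivial⟩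

theorem bot_mem_closedTwoStepSubideals : ⊥ ∈ closedTwoStepSubideals L := by
  refine mem_closedTwoStepSubideals.mpr ⟨⊤, fun _ _ => trivial, fun k _ y hy => ?_⟩
  rw [ClosedSubmodule.mem_bot] at hy ⊢
  rw [hy, lie_zero]

theorem isPComplete_closedSubalgebras : IsPComplete (closedSubalgebras L) := by
  have htop : ⊤ ∈ closedSubalgebras L :=
    closedTwoStepSubideals_subset top_mem_closedTwoStepSubideals
  refine isPComplete_of_sInf_mem (fun S hS _ => mem_closedSubalgebras.mpr fun x hx y hy => ?_)
    ((top_le_iff.mp (le_sSup htop) : ss _ = ⊤) ▸ htop)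
  rw [ClosedSubmodule.mem_sInf] at hx hy ⊢
  exact fun Y hY => mem_closedSubalgebras.mp (hS hY) x (hx Y hY) y (hy Y hY)

theorem isPComplete_closedTwoStepSubideals : IsPComplete (closedTwoStepSubideals L) := by
  have htop := top_mem_closedTwoStepSubideals (L := L)
  refine isPComplete_of_sInf_mem (fun S hS _ => mem_closedTwoStepSubideals.mpr ?_)
    ((top_le_iff.mp (le_sSup htop) : ss _ = ⊤) ▸ htop)
  choose! K hYK hK using fun Y (hY : Y ∈ S) => mem_closedTwoStepSubideals.mp (hS hY)
  have hmem : ∀ z, z ∈ sInf (K '' S) ↔ ∀ Y ∈ S, z ∈ K Y := fun z => by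
    rw [← SetLike.mem_coe, LieSubmodule.coe_sInf]
    simp
  refine ⟨sInf (K '' S), fun y hy => ?_, fun k hk y hy => ?_⟩
  · rw [ClosedSubmodule.mem_sInf] at hy
    exact (hmem y).mpr fun Y hY => hYK Y hY y (hy Y hY)
  · rw [ClosedSubmodule.mem_sInf] at hy ⊢
    exact fun Y hY => hK Y hY k ((hmem k).mp hk Y hY) y (hy Y hY)

theorem IsFrattiniSemisimple.exists_notMem_frattiniSeries_add_one (hL : IsFrattiniSemisimple L)
    {Z : ClosedSubmodule ℂ L} (hZ : Z ≠ ⊥) :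
    ∃ β : Ordinal.{u}, (∀ z ∈ Z, z ∈ frattiniSeries L β) ∧
      ∃ z ∈ Z, z ∉ frattiniSeries L (β + 1) := by
  by_contra! h
  refine hZ (le_bot_iff.mp fun z hz => ?_)
  have hall : ∀ α : Ordinal.{u}, ∀ z ∈ Z, z ∈ frattiniSeries L α := by
    intro α
    induction α using Ordinal.limitRecOn with
    | zero =>
      rw [frattiniSeries_zero]
      exact fun z _ => LieSubalgebra.mem_top z
    | add_one β ih => exact h β ih
    | limit β hβ ih =>
      rw [frattiniSeries_limit L β hβ]
      exact fun z hz => mem_iInf_lieSubalgebra.mpr fun γ => ih γ.1 γ.2 z hz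
  have hz' : z ∈ frattiniRadical L := hall _ z hz
  rw [hL] at hz'
  exact ClosedSubmodule.mem_bot.mpr ((LieSubalgebra.mem_bot z).mp hz')

/-- Some closed ideal `J` of finite codimension in `M` misses `z₀`, and `Z / (Z ∩ J)` embeds in `M /
J`. -/
theorem exists_finiteGap_of_notMem_idealPreradicalOf {M : LieSubalgebra ℂ L}
    (hM : IsClosed (M : Set L)) {Z : ClosedSubmodule ℂ L} (hZM : ∀ z ∈ Z, z ∈ M) {z₀ : L}
    (hz₀ : z₀ ∈ Z) (hz₀' : z₀ ∉ idealPreradicalOf L M) :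
    ∃ J : ClosedSubmodule ℂ L, (∀ k ∈ M, ∀ z ∈ J, ⁅k, z⁆ ∈ J) ∧ FiniteGap (Z ⊓ J) Z := by
  rw [mem_idealPreradicalOf] at hz₀'
  push Not at hz₀'
  obtain ⟨I, hIc, -, hIf, hzI⟩ := hz₀' (hZM z₀ hz₀)
  let J : ClosedSubmodule ℂ L :=
    { I.toSubmodule.map M.toSubmodule.subtype with
      isClosed' := hM.isClosedEmbedding_subtypeVal.isClosedMap _ hIc }
  have hJ : ∀ z, z ∈ J ↔ ∃ w : M, w ∈ I ∧ (w : L) = z := fun z => Iff.rfl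
  refine ⟨J, ?_, ?_, ?_⟩
  · intro k hk z hz
    obtain ⟨w, hw, rfl⟩ := (hJ z).mp hz
    exact (hJ _).mpr ⟨⁅(⟨k, hk⟩ : M), w⁆, I.lie_mem hw, rfl⟩
  · refine lt_of_le_of_ne inf_le_left fun h => ?_
    obtain ⟨w, hw, hwz⟩ := (hJ z₀).mp ((inf_eq_left.mp h) hz₀)
    exact hzI (by rwa [← (Subtype.ext hwz : w = ⟨z₀, hZM z₀ hz₀⟩)])
  · let ψ : Z.toSubmodule →ₗ[ℂ] (M ⧸ I.toSubmodule) :=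
      I.toSubmodule.mkQ ∘ₗ Submodule.inclusion (p' := M.toSubmodule) hZM
    have hker : (Z ⊓ J).toSubmodule.submoduleOf Z.toSubmodule = LinearMap.ker ψ := by
      ext z
      rw [LinearMap.mem_ker]
      change ((z : L) ∈ Z ⊓ J) ↔ Submodule.Quotient.mk (⟨z, hZM z z.2⟩ : M) = 0
      rw [Submodule.Quotient.mk_eq_zero, ClosedSubmodule.mem_inf, hJ]
      constructor
      · rintro ⟨-, w, hw, hwz⟩
        have hw' : w = ⟨z, hZM z z.2⟩ := Subtype.ext hwz
        exact hw' ▸ hw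
      · exact fun hz => ⟨z.2, _, hz, rfl⟩
    rw [hker]
    have : FiniteDimensional ℂ (M ⧸ I.toSubmodule) := hIf
    exact Module.Finite.equiv ψ.quotKerEquivRange.symm

/-- In an `𝓕`-semisimple algebra, every nonzero closed subspace has a finite gap below it, cut out
by a closed ideal of a term of the Frattini series. -/
theorem IsFrattiniSemisimple.exists_finiteGap (hL : IsFrattiniSemisimple L)
    {Z : ClosedSubmodule ℂ L} (hZ : Z ≠ ⊥) :
    ∃ (K : LieIdeal ℂ L) (J : ClosedSubmodule ℂ L), (∀ z ∈ Z, z ∈ K) ∧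
      (∀ k ∈ K, ∀ z ∈ J, ⁅k, z⁆ ∈ J) ∧ FiniteGap (Z ⊓ J) Z := by
  obtain ⟨β, hZβ, z₀, hz₀, hz₀'⟩ := hL.exists_notMem_frattiniSeries_add_one hZ
  rw [frattiniSeries_add_one] at hz₀'
  obtain ⟨hc, hl⟩ := frattiniSeries_isClosed_and_lie_mem (L := L) β
  obtain ⟨J, hJ, hgap⟩ := exists_finiteGap_of_notMem_idealPreradicalOf hc hZβ hz₀ hz₀'
  exact ⟨{ (frattiniSeries L β).toSubmodule with lie_mem := fun {a z} hz => hl a z hz }, J, hZβ,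
    hJ, hgap⟩

theorem IsFrattiniSemisimple.isLowerFiniteGap_closedSubalgebras (hL : IsFrattiniSemisimple L) :
    IsLowerFiniteGap (closedSubalgebras L) := by
  intro Z hZ hne
  rw [pp, le_bot_iff.mp (sInf_le (closedTwoStepSubideals_subset bot_mem_closedTwoStepSubideals))]
    at hne
  obtain ⟨K, J, hZK, hK, hgap⟩ := hL.exists_finiteGap hne
  refine ⟨Z ⊓ J, mem_closedSubalgebras.mpr fun x hx y hy => ?_, hgap⟩
  rw [ClosedSubmodule.mem_inf] at hx hy ⊢
  exact ⟨mem_closedSubalgebras.mp hZ x hx.1 y hy.1, hK x (hZK x hx.1) y hy.2⟩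

theorem IsFrattiniSemisimple.isLowerFiniteGap_closedTwoStepSubideals
    (hL : IsFrattiniSemisimple L) : IsLowerFiniteGap (closedTwoStepSubideals L) := by
  intro Z hZ hne
  rw [pp, le_bot_iff.mp (sInf_le bot_mem_closedTwoStepSubideals)] at hne
  obtain ⟨K, J, hZK, hK, hgap⟩ := hL.exists_finiteGap hne
  obtain ⟨K', hZK', hK'⟩ := mem_closedTwoStepSubideals.mp hZ
  -- Elements of `K'` preserve `Z` and those of `K` preserve `J`, so the intersection of the two
  -- ideals serves as the intermediate ideal.
  refine ⟨Z ⊓ J, mem_closedTwoStepSubideals.mpr ⟨K ⊓ K', fun y hy => ?_, fun k hk y hy => ?_⟩, hgap⟩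
  · rw [ClosedSubmodule.mem_inf] at hy
    exact (LieSubmodule.mem_inf ..).mpr ⟨hZK y hy.1, hZK' y hy.1⟩
  · rw [ClosedSubmodule.mem_inf] at hy ⊢
    rw [LieSubmodule.mem_inf] at hk
    exact ⟨hK' k hk.2 y hy.1, hK k hk.1 y hy.2⟩

theorem idealPreradicalOf_frattiniRadical :
    idealPreradicalOf L (frattiniRadical L) = frattiniRadical L := by
  rw [frattiniRadical, ← frattiniSeries_add_one]
  exact csInf_mem (exists_frattiniSeries_stable L)

/-- Let `Z` be the least member of `C` containing the radical `M`. If `M ≠ 0`, the member `Y` just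
below `Z` does not contain `M`, and `M / (M ∩ Y)` embeds in the finite-dimensional `Z / Y`; hence
`P(M) ≠ M`, against stability. -/
theorem isFrattiniSemisimple_of_chain {C : Set (ClosedSubmodule ℂ L)}
    (hC : C ⊆ closedSubalgebras L) (hchain : IsCompleteLowerFiniteGapChain C) :
    IsFrattiniSemisimple L := by
  obtain ⟨-, ⟨hp, -⟩, hgap, hpp, hss⟩ := hchain
  set M := frattiniRadical L with hM
  have hMc : IsClosed (M : Set L) := (frattiniSeries_isClosed_and_lie_mem _).1
  by_contra hne
  let S : Set (ClosedSubmodule ℂ L) := {Y | Y ∈ C ∧ ∀ z ∈ M, z ∈ Y}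
  have hSne : S.Nonempty := ⟨⊤, hss ▸ hp.ss_mem, fun _ _ => trivial⟩
  have hZ : sInf S ∈ C := hp.sInf_mem (fun Y hY => hY.1) hSne
  have hMZ : ∀ z ∈ M, z ∈ sInf S := fun z hz => ClosedSubmodule.mem_sInf.mpr fun Y hY => hY.2 z hz
  have hZ0 : sInf S ≠ pp C := by
    rw [hpp]
    intro h0
    rw [h0] at hMZ
    exact hne (le_bot_iff.mp fun z hz =>
      (LieSubalgebra.mem_bot z).mpr (ClosedSubmodule.mem_bot.mp (hMZ z hz)))
  obtain ⟨Y, hY, hYZ, hfin⟩ := hgap _ hZ hZ0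
  obtain ⟨H, hH⟩ := hC hY
  have hHY : ∀ z, z ∈ H ↔ z ∈ Y := fun z => SetLike.ext_iff.mp hH z
  have hHc : IsClosed (H : Set L) := by
    have : (H : Set L) = Y := Set.ext hHY
    rw [this]
    exact Y.isClosed
  refine idealPreradicalOf_ne_self hMc hHc ?_ ?_ idealPreradicalOf_frattiniRadical
  · exact fun hle => hYZ.not_ge (sInf_le ⟨hY, fun z hz => (hHY z).mp (hle hz)⟩)
  · let ψ : M.toSubmodule →ₗ[ℂ]
        ((sInf S).toSubmodule ⧸ Y.toSubmodule.submoduleOf (sInf S).toSubmodule) :=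
      Submodule.mkQ _ ∘ₗ Submodule.inclusion (p' := (sInf S).toSubmodule) hMZ
    have hker : H.toSubmodule.comap M.toSubmodule.subtype = LinearMap.ker ψ := by
      ext z
      rw [LinearMap.mem_ker]
      change ((z : L) ∈ H) ↔ Submodule.Quotient.mk (⟨z, hMZ z z.2⟩ : (sInf S).toSubmodule) = 0
      rw [Submodule.Quotient.mk_eq_zero, hHY]
      rfl
    rw [hker]
    exact Module.Finite.equiv ψ.quotKerEquivRange.symm

end Subalgebras

end BanachLie

/-! ### The equivalences -/

theorem theorem8p6 (L : Type u) [BanachLieAlgebra L] :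
    List.TFAE [
      BanachLie.IsFrattiniSemisimple L,
      ∃ C : Set (ClosedSubmodule ℂ L),
        C ⊆ BanachLie.closedTwoStepSubideals L ∧ BanachLie.IsCompleteLowerFiniteGapChain C,
      ∃ C : Set (ClosedSubmodule ℂ L),
        C ⊆ BanachLie.closedSubalgebras L ∧ BanachLie.IsCompleteLowerFiniteGapChain C,
      BanachLie.IsPComplete (BanachLie.closedTwoStepSubideals L) ∧
        BanachLie.IsLowerFiniteGap (BanachLie.closedTwoStepSubideals L),
      BanachLie.IsPComplete (BanachLie.closedSubalgebras L) ∧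
        BanachLie.IsLowerFiniteGap (BanachLie.closedSubalgebras L)] := by
  open BanachLie in
  tfae_have 1 → 4 := fun h =>
    ⟨isPComplete_closedTwoStepSubideals, h.isLowerFiniteGap_closedTwoStepSubideals⟩
  tfae_have 1 → 5 := fun h =>
    ⟨isPComplete_closedSubalgebras, h.isLowerFiniteGap_closedSubalgebras⟩
  tfae_have 4 → 2 := fun h => exists_isCompleteLowerFiniteGapChain h.1
    top_mem_closedTwoStepSubideals bot_mem_closedTwoStepSubideals h.2
  tfae_have 5 → 3 := fun h => exists_isCompleteLowerFiniteGapChain h.1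
    (closedTwoStepSubideals_subset top_mem_closedTwoStepSubideals)
    (closedTwoStepSubideals_subset bot_mem_closedTwoStepSubideals) h.2
  tfae_have 2 → 3 := fun ⟨C, hC, h⟩ => ⟨C, hC.trans closedTwoStepSubideals_subset, h⟩
  tfae_have 3 → 1 := fun ⟨_, hC, h⟩ => isFrattiniSemisimple_of_chain hC h
  tfae_finish
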